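/- Let $(\mathfrak X,\mathcal S,\pi)$ be a probability space and let $\mathcal B$ be the Banach space of bounded measurable functions $w:\mathfrak X\to\mathbb C$ with $\|w\|=\sup_x|w_x|$. Write $\langle u,w\rangle=\int\overline{u_x}\,w_x\,\pi(\mathrm dx)$ and $\langle w\rangle=\langle 1,w\rangle$. Let $a\in\mathcal B$ be real valued and let $S:\mathcal B\to\mathcal B$ be a bounded linear operator. Assume: * (A1) $\langle u,Sw\rangle=\langle Su,w\rangle$ for all $u,w\in\mathcal B$, and $Sp\ge 0$ for every real valued $p\in\mathcal B$ with $p\ge0$. * (A2) There is a measurable kernel $(x,y)\mapsto S_{xy}=S_{yx}\in[0,\infty)$ with $\sup_x\int S_{xy}^2\,\pi(\mathrm dy)<\infty$ and $(Sw)_x=\int S_{xy}w_y\,\pi(\mathrm dy)$ for all $w\in\mathcal B$, $x\in\mathfrak X$. * (No outliers) With the rows $S_x:y\mapsto S_{xy}$ and the norm $\|\cdot\|_2$ of $L^2(\pi)$, $$\lim_{\varepsilon\downarrow0}\ \inf_{x\in\mathfrak X}\int_{\mathfrak X}\frac{\pi(\mathrm dy)}{\varepsilon+(a_x-a_y)^2+\|S_x-S_y\|_2^2}=\infty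 .$$ We say that $S$ satisfies (A3) if there are an integer $L\ge1$ and $\rho>0$ such that $(S^Lu)_x\ge\rho\,\langle u\rangle$ for all real valued $u\in\mathcal B$ with $u\ge0$ and all $x\in\mathfrak X$. A $K\times K$ matrix $T$ with non-negative entries is fully indecomposable if for all non-empty $I,J\subseteq\{1,\dots,K\}$ with $|I|+|J|\ge K$ the submatrix $(T_{ij})_{i\in I,j\in J}$ has a non-zero entry. We say that $S$ is block fully indecomposable if there are an integer $K\ge1$, a fully indecomposable $K\times K$ matrix $T$ and a measurable partition $I_1,\dots,I_K$ of $\mathfrak X$ with $\pi(I_i)=1/K$ and $S_{xy}\ge T_{ij}$ for all $(x,y)\in I_i\times I_j$ and all $i,j$. Suppose that at least one of the following holds: * (i) $a=0$ and $S$ is block fully indecomposable; * (ii) $S$ satisfies (A3) and $$\inf\Big\{\frac{\langle w,Sw\rangle}{\langle w\rangle^2}:\ w\in\mathcal B,\ w\ge0,\ \langle w\rangle\ne0\Big\}>0 .$$ Then the quadratic vector equation $$-\frac1{m_x(z)}=z+a_x+(Sm(z))_x,\qquad x\in\mathfrak X,\ \operatorname{Im}z>0,$$ has a unique solution $m:\{z\in\mathbb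 C:\operatorname{Im}z>0\}\to\{w\in\mathcal B:\operatorname{Im}w_x>0\ \text{for all }x\}$, and this solution is uniformly bounded: $$|||m|||_{\mathbb R}:=\sup\{\|m(z)\|:\operatorname{Re}z\in\mathbb R,\ \operatorname{Im}z>0\}<\infty .$$ Moreover, in case (i), $S$ satisfies (A3). -/

import Mathlib

open MeasureTheory Filter Topology Set
open scoped ENNReal ComplexConjugate UpperHalfPlane

noncomputable section

namespace QVE

/-- The bounded measurable functions `X → ℂ`, as a subspace of the space `ℓ^∞(X)` of all bounded
functions with the supremum norm. -/
def boundedMeasurable (X : Type*) [MeasurableSpace X] :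
    Submodule ℂ (lp (fun _ : X => ℂ) ∞) where
  carrier := {w | Measurable (w : X → ℂ)}
  add_mem' := fun {u w} hu hw => by
    simp only [mem_ofPred_eq, lp.coeFn_add] at *
    exact hu.add hw
  zero_mem' := by
    simp only [mem_ofPred_eq, lp.coeFn_zero]
    exact measurable_zero
  smul_mem' := fun c w hw => by
    simp only [mem_ofPred_eq, lp.coeFn_smul] at *
    exact hw.const_smul c

/-- The space `𝓑` of bounded measurable functions `X → ℂ` with the supremum norm. -/
abbrev BB (X : Type*) [MeasurableSpace X] : Type _ := boundedMeasurable X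

instance (X : Type*) [MeasurableSpace X] : CoeFun (BB X) (fun _ => X → ℂ) :=
  ⟨fun w x => (w : lp (fun _ : X => ℂ) ∞) x⟩

/-- The norm on `𝓑` is the supremum norm. -/
theorem norm_eq_iSup {X : Type*} [MeasurableSpace X] (w : BB X) : ‖w‖ = ⨆ x, ‖w x‖ :=
  lp.norm_eq_ciSup (w : lp (fun _ : X => ℂ) ∞)

variable {X : Type*} [MeasurableSpace X]

/-- `w` is real valued. -/
def IsRealValued (w : BB X) : Prop := ∀ x, (w x).im = 0

/-- `w` is real valued and non-negative. -/
def IsNonneg (w : BB X) : Prop := ∀ x, (w x).im = 0 ∧ 0 ≤ (w x).re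

/-- The pairing `⟨u, w⟩ = ∫ conj (u_x) w_x π(dx)`. -/
def pairing (μ : Measure X) (u w : BB X) : ℂ := ∫ x, conj (u x) * w x ∂μ

/-- The average `⟨w⟩ = ∫ w_x π(dx)`. -/
def avg (μ : Measure X) (w : BB X) : ℂ := ∫ x, w x ∂μ

/-- Condition A1: `S` is symmetric and positivity preserving. -/
def IsSymmetricPositive (μ : Measure X) (S : BB X →L[ℂ] BB X) : Prop :=
  (∀ u w : BB X, pairing μ u (S w) = pairing μ (S u) w) ∧
    ∀ p : BB X, IsNonneg p → IsNonneg (S p)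

/-- Condition A2: `S` is smoothing and `k` is its kernel, i.e. `k x y = S_{xy}` is a symmetric,
non-negative, measurable function with `sup_x (∫ S_{xy}² π(dy))^{1/2} < ∞` and
`(S w)_x = ∫ S_{xy} w_y π(dy)`. -/
structure IsSmoothingWithKernel (μ : Measure X) (S : BB X →L[ℂ] BB X) (k : X → X → ℝ) :
    Prop where
  measurable : Measurable (Function.uncurry k)
  nonneg : ∀ x y, 0 ≤ k x y
  symm : ∀ x y, k x y = k y x
  bounded : ⨆ x, eLpNorm (k x) 2 μ < ∞
  apply_eq : ∀ (w : BB X) (x : X), S w x = ∫ y, (k x y : ℂ) * w y ∂μ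

/-- Condition A3: `S` is uniformly primitive. -/
def IsUniformlyPrimitive (μ : Measure X) (S : BB X →L[ℂ] BB X) : Prop :=
  ∃ L : ℕ, 1 ≤ L ∧ ∃ ρ : ℝ, 0 < ρ ∧
    ∀ u : BB X, IsNonneg u → ∀ x, ρ * (avg μ u).re ≤ ((S ^ L) u x).re

/-- The no-outlier condition
`lim_{ε ↓ 0} inf_x ∫ π(dy) / (ε + (a_x - a_y)² + ‖S_x - S_y‖₂²) = ∞`. -/
def NoOutliers (μ : Measure X) (k : X → X → ℝ) (a : BB X) : Prop :=
  Tendsto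
    (fun ε : ℝ => ⨅ x, ∫⁻ y, ENNReal.ofReal
      (1 / (ε + ‖a x - a y‖ ^ 2 + ∫ u, (k x u - k y u) ^ 2 ∂μ)) ∂μ)
    (𝓝[>] 0) (𝓝 ∞)

/-- A matrix with non-negative entries is fully indecomposable if every submatrix on non-empty
sets of rows `I` and columns `J` with `|I| + |J| ≥ K` has a non-zero entry. -/
def IsFullyIndecomposable {K : ℕ} (T : Matrix (Fin K) (Fin K) ℝ) : Prop :=
  (∀ i j, 0 ≤ T i j) ∧
    ∀ I J : Finset (Fin K), I.Nonempty → J.Nonempty → K ≤ I.card + J.card →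
      ∃ i ∈ I, ∃ j ∈ J, T i j ≠ 0

/-- The integral operator with kernel `k` is block fully indecomposable. -/
def IsBlockFullyIndecomposable (μ : Measure X) (k : X → X → ℝ) : Prop :=
  ∃ K : ℕ, 1 ≤ K ∧ ∃ T : Matrix (Fin K) (Fin K) ℝ, IsFullyIndecomposable T ∧
    ∃ B : Fin K → Set X,
      (∀ i, MeasurableSet (B i)) ∧ Pairwise (fun i j => Disjoint (B i) (B j)) ∧
      (⋃ i, B i) = univ ∧
      (∀ i, μ (B i) = (K : ℝ≥0∞)⁻¹) ∧
      ∀ i j, ∀ x ∈ B i, ∀ y ∈ B j, T i j ≤ k x y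

/-- The strong diagonal condition: the infimum of `⟨w, S w⟩ / ⟨w⟩²` over all non-negative `w` for
which the quotient makes sense is positive. -/
def HasStrongDiagonal (μ : Measure X) (S : BB X →L[ℂ] BB X) : Prop :=
  0 < sInf {r : ℝ | ∃ w : BB X, IsNonneg w ∧ avg μ w ≠ 0 ∧
    r = (pairing μ w (S w)).re / (avg μ w).re ^ 2}

/-- `m` solves the quadratic vector equation `-1/m(z) = z + a + S m(z)`, with values in the
functions with positive imaginary part. -/
def IsSolution (S : BB X →L[ℂ] BB X) (a : BB X) (m : ℍ → BB X) : Prop :=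
  ∀ z : ℍ, ∀ x, 0 < (m z x).im ∧ -(1 / m z x) = (z : ℂ) + a x + S (m z) x

/-- The seminorm `|||w|||_I = sup {‖w(z)‖ : Re z ∈ I, Im z > 0}`, with values in `[0, ∞]`. -/
def nnorm (I : Set ℝ) (w : ℍ → BB X) : ℝ≥0∞ :=
  ⨆ z : ℍ, ⨆ _ : z.re ∈ I, ENNReal.ofReal ‖w z‖

end QVE

end

open QVE

/-! Write `u` for the solution at a fixed `z` and `η = Im z`. Existence and uniqueness come from a
contraction: `u ↦ -1/(z + a + Su)` contracts the hyperbolic quantity `sup |u - w|² / (Im u · Im w)`,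
because every denominator has the extra imaginary part `η` on top of `S Im u`
(`qveMap_contraction`).

The uniform bound is a bootstrap L¹ → L² → sup. The imaginary part of the equation says `|u|² S Im u
≤ Im u`, so the symmetric operator `|u| S |u|` has a positive sub-invariant function, and a Schur
test gives `‖|u| S|u|‖₂ ≤ 1` (`integral_sq_mul_kop_le`). This yields an L² bound for `|z|` larger
than `‖a‖`, and, for bounded `z`, an L² bound from an L¹ bound (`integral_sq_le`). From L² to sup:
if `|u_x|` is huge then `1/u_y` is controlled by `|a_x - a_y|` and `‖S_x - S_y‖₂`, so the no-outlier
integral would be bounded by the L² norm (`NoOutliers.exists_bound`).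

In case (ii) the L¹ bound is immediate from `c⟨|u|⟩² ≤ ⟨|u|, S|u|⟩ ≤ 1`. In case (i), `a = 0`, so
only a neighbourhood of `z = 0` is left. On the imaginary axis `u = iv` with `v(η + Sv) = 1`. An
entropy inequality bounds `∫ log v` from below (`le_integral_log`), while `v_x v_y S_xy` bounds
products of block averages of `v` from above along non-zero entries of `T`. Full indecomposability
provides, by Hall's theorem, enough diagonals of `T` to bound each average (`le_of_mul_le`).

To leave the axis, put `u = iv(1 + h)`. The equation becomes `h + Ph = h²/(1+h) + i(z - iη)v` with
`P = vSv` and `P1 ≤ 1`. The danger is an eigenvalue `-1` of `P`; it is excluded because an odd power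
of `P` dominates a multiple of the average (`exists_right_inverse_of_odd_pow`). A fixed point
argument then gives `h`, and uniqueness identifies the result with the given solution. -/

namespace QVE

/-! ### Bounded measurable functions, completeness, Cauchy–Schwarz -/

section Basic

variable {X : Type*} [MeasurableSpace X]

/-- Bounded measurable functions. -/
def BddMeas {E : Type*} [NormedAddCommGroup E] [MeasurableSpace E] (f : X → E) : Prop :=
  Measurable f ∧ ∃ C, ∀ x, ‖f x‖ ≤ C

namespace BddMeas

theorem const {E : Type*} [NormedAddCommGroup E] [MeasurableSpace E] (c : E) :
    BddMeas (fun _ : X => c) :=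
  ⟨measurable_const, ‖c‖, fun _ => le_rfl⟩

theorem exists_nonneg {E : Type*} [NormedAddCommGroup E] [MeasurableSpace E] {f : X → E}
    (hf : BddMeas f) : ∃ C, 0 ≤ C ∧ ∀ x, ‖f x‖ ≤ C := by
  obtain ⟨-, C, hC⟩ := hf
  exact ⟨max C 0, le_max_right _ _, fun x => (hC x).trans (le_max_left _ _)⟩

theorem add {E : Type*} [NormedAddCommGroup E] [MeasurableSpace E] [MeasurableAdd₂ E] {f g : X → E}
    (hf : BddMeas f) (hg : BddMeas g) : BddMeas (fun x => f x + g x) := by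
  obtain ⟨mf, C, hC⟩ := hf
  obtain ⟨mg, D, hD⟩ := hg
  exact ⟨mf.add mg, C + D, fun x => norm_add_le_of_le (hC x) (hD x)⟩

theorem sub {E : Type*} [NormedAddCommGroup E] [MeasurableSpace E] [MeasurableSub₂ E] {f g : X → E}
    (hf : BddMeas f) (hg : BddMeas g) : BddMeas (fun x => f x - g x) := by
  obtain ⟨mf, C, hC⟩ := hf
  obtain ⟨mg, D, hD⟩ := hg
  exact ⟨mf.sub mg, C + D, fun x => norm_sub_le_of_le (hC x) (hD x)⟩

theorem mul {E : Type*} [NormedRing E] [MeasurableSpace E] [MeasurableMul₂ E] {f g : X → E}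
    (hf : BddMeas f) (hg : BddMeas g) : BddMeas (fun x => f x * g x) := by
  obtain ⟨C, hC0, hC⟩ := hf.exists_nonneg
  obtain ⟨D, hD0, hD⟩ := hg.exists_nonneg
  exact ⟨hf.1.mul hg.1, C * D, fun x => (norm_mul_le _ _).trans
    (mul_le_mul (hC x) (hD x) (norm_nonneg _) hC0)⟩

theorem pow_two {f : X → ℝ} (hf : BddMeas f) : BddMeas (fun x => f x ^ 2) := by
  simpa only [sq] using hf.mul hf

theorem norm {f : X → ℂ} (hf : BddMeas f) : BddMeas (fun x => ‖f x‖) :=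
  ⟨hf.1.norm, hf.2.imp fun C hC x => by simpa using hC x⟩

theorem re {f : X → ℂ} (hf : BddMeas f) : BddMeas (fun x => (f x).re) :=
  ⟨Complex.measurable_re.comp hf.1, hf.2.imp fun _ hC x =>
    (Complex.abs_re_le_norm _).trans (hC x)⟩

theorem im {f : X → ℂ} (hf : BddMeas f) : BddMeas (fun x => (f x).im) :=
  ⟨Complex.measurable_im.comp hf.1, hf.2.imp fun _ hC x =>
    (Complex.abs_im_le_norm _).trans (hC x)⟩

theorem ofReal {f : X → ℝ} (hf : BddMeas f) : BddMeas (fun x => (f x : ℂ)) :=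
  ⟨Complex.measurable_ofReal.comp hf.1, hf.2.imp fun C hC x => by simpa using hC x⟩

theorem inv {𝕜 : Type*} [NormedField 𝕜] [MeasurableSpace 𝕜] [MeasurableInv 𝕜] {f : X → 𝕜}
    (hf : BddMeas f) {c : ℝ} (hc : 0 < c) (h : ∀ x, c ≤ ‖f x‖) : BddMeas (fun x => (f x)⁻¹) :=
  ⟨hf.1.inv, c⁻¹, fun x => by
    rw [norm_inv]
    exact inv_anti₀ hc (h x)⟩

theorem integrable {μ : Measure X} [IsFiniteMeasure μ] {E : Type*} [NormedAddCommGroup E]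
    [MeasurableSpace E] [BorelSpace E] [SecondCountableTopology E] {f : X → E}
    (hf : BddMeas f) : Integrable f μ := by
  obtain ⟨mf, C, hC⟩ := hf
  exact Integrable.of_bound mf.aestronglyMeasurable C (ae_of_all _ hC)

end BddMeas

open Classical in
/-- The element of `𝓑` given by a bounded measurable function (zero if it is not one). -/
noncomputable def ofFun (f : X → ℂ) : BB X :=
  if h : BddMeas f then
    ⟨⟨f, memℓp_infty ⟨h.2.choose, by rintro _ ⟨x, rfl⟩; exact h.2.choose_spec x⟩⟩, h.1⟩
  else 0

theorem ofFun_apply {f : X → ℂ} (hf : BddMeas f) (x : X) : ofFun f x = f x := by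
  rw [ofFun, dif_pos hf]

namespace BB

theorem norm_apply_le (w : BB X) (x : X) : ‖w x‖ ≤ ‖w‖ :=
  lp.norm_apply_le_norm ENNReal.top_ne_zero (w : lp (fun _ : X => ℂ) ∞) x

theorem norm_le {w : BB X} {C : ℝ} (hC : 0 ≤ C) (h : ∀ x, ‖w x‖ ≤ C) : ‖w‖ ≤ C :=
  lp.norm_le_of_forall_le hC h

theorem bddMeas (w : BB X) : BddMeas (w : X → ℂ) :=
  ⟨w.2, ‖w‖, norm_apply_le w⟩

theorem ext {u w : BB X} (h : ∀ x, u x = w x) : u = w :=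
  Subtype.ext (lp.ext (funext h))

@[simp] theorem add_apply (u w : BB X) (x : X) : (u + w) x = u x + w x := rfl
@[simp] theorem sub_apply (u w : BB X) (x : X) : (u - w) x = u x - w x := rfl
@[simp] theorem smul_apply (c : ℂ) (w : BB X) (x : X) : (c • w) x = c * w x := rfl
@[simp] theorem zero_apply (x : X) : (0 : BB X) x = 0 := rfl

end BB

instance : CompleteSpace (BB X) := by
  have : IsClosed (boundedMeasurable X : Set (lp (fun _ : X => ℂ) ∞)) := by
    refine IsSeqClosed.isClosed fun u w hu hw => ?_
    refine measurable_of_tendsto_metrizable (f := fun n => ((u n : lp (fun _ : X => ℂ) ∞) : X → ℂ))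
      hu (tendsto_pi_nhds.2 fun x => ?_)
    rw [tendsto_iff_norm_sub_tendsto_zero] at hw ⊢
    exact squeeze_zero (fun _ => norm_nonneg _)
      (fun n => lp.norm_apply_le_norm ENNReal.top_ne_zero (u n - w) x) hw
  exact this.completeSpace_coe

/-- The Cauchy–Schwarz inequality for functions with `f ^ 2 ≤ p q`. -/
theorem sq_integral_le {μ : Measure X} {f p q : X → ℝ} (hf : Integrable f μ) (hp : Integrable p μ)
    (hq : Integrable q μ) (hp0 : ∀ x, 0 ≤ p x) (hq0 : ∀ x, 0 ≤ q x)
    (h : ∀ x, f x ^ 2 ≤ p x * q x) : (∫ x, f x ∂μ) ^ 2 ≤ (∫ x, p x ∂μ) * ∫ x, q x ∂μ := by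
  -- The quadratic `t²p - 2tf + q` is pointwise non-negative, so its integral has non-positive
  -- discriminant.
  have key : ∀ t : ℝ, 0 ≤ (∫ x, p x ∂μ) * (t * t) + (-2 * ∫ x, f x ∂μ) * t + ∫ x, q x ∂μ := by
    intro t
    have h1 : 0 ≤ ∫ x, (t ^ 2 * p x - 2 * t * f x + q x) ∂μ := by
      refine integral_nonneg fun x => ?_
      simp only [Pi.zero_apply]
      rcases (hp0 x).eq_or_lt with h0 | h0
      · have : f x = 0 := by
          have := h x
          rw [← h0, zero_mul] at this
          exact pow_eq_zero_iff two_ne_zero |>.1 (le_antisymm this (sq_nonneg _))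
        rw [← h0, this]
        simpa using hq0 x
      · refine nonneg_of_mul_nonneg_right ?_ h0
        nlinarith [sq_nonneg (t * p x - f x), h x]
    have e1 : ∫ x, (t ^ 2 * p x - 2 * t * f x + q x) ∂μ
        = ∫ x, (t ^ 2 * p x - 2 * t * f x) ∂μ + ∫ x, q x ∂μ :=
      integral_add ((hp.const_mul _).sub (hf.const_mul _)) hq
    rw [e1, integral_sub (hp.const_mul _) (hf.const_mul _), integral_const_mul, integral_const_mul] at h1
    linarith
  have := discrim_le_zero key
  rw [discrim] at this
  nlinarith

end Basic

/-! ### The integral operator on real functions -/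

section Kernel

variable {X : Type*} [MeasurableSpace X]

/-- The integral operator with kernel `k` on real functions. -/
noncomputable def kop (μ : Measure X) (k : X → X → ℝ) (f : X → ℝ) (x : X) : ℝ :=
  ∫ y, k x y * f y ∂μ

variable {μ : Measure X} {S : BB X →L[ℂ] BB X} {k : X → X → ℝ}

theorem kop_nonneg (hk : IsSmoothingWithKernel μ S k) {f : X → ℝ} (hf : ∀ x, 0 ≤ f x) (x : X) :
    0 ≤ kop μ k f x :=
  integral_nonneg fun y => mul_nonneg (hk.nonneg x y) (hf y)

theorem kop_const_mul (c : ℝ) (f : X → ℝ) (x : X) :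
    kop μ k (fun y => c * f y) x = c * kop μ k f x := by
  simp only [kop, mul_left_comm]
  exact integral_const_mul _ _

namespace IsSmoothingWithKernel

theorem memLp (hk : IsSmoothingWithKernel μ S k) (x : X) : MemLp (k x) 2 μ :=
  ⟨(hk.measurable.of_uncurry_left).aestronglyMeasurable,
    (le_iSup (fun x => eLpNorm (k x) 2 μ) x).trans_lt hk.bounded⟩

theorem norm_apply_le (hk : IsSmoothingWithKernel μ S k) (w : BB X) (x : X) :
    ‖S w x‖ ≤ kop μ k (fun y => ‖w y‖) x := by
  rw [hk.apply_eq, kop]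
  refine (norm_integral_le_integral_norm _).trans (le_of_eq ?_)
  refine integral_congr_ae (ae_of_all _ fun y => ?_)
  simp [abs_of_nonneg (hk.nonneg x y)]

theorem exists_sq_bound (hk : IsSmoothingWithKernel μ S k) :
    ∃ C : ℝ, 1 ≤ C ∧ ∀ x, ∫ y, k x y ^ 2 ∂μ ≤ C := by
  set B := ⨆ x, eLpNorm (k x) 2 μ with hB
  refine ⟨max 1 (B.toReal ^ 2), le_max_left _ _, fun x => le_max_of_le_right ?_⟩
  have h1 : eLpNorm (k x) 2 μ ≤ B := le_iSup (fun x => eLpNorm (k x) 2 μ) x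
  have h2 := (ENNReal.toReal_le_toReal (hk.memLp x).2.ne hk.bounded.ne).2 h1
  have h3 : (eLpNorm (k x) 2 μ).toReal ^ 2 = ∫ y, k x y ^ 2 ∂μ := by
    rw [(hk.memLp x).eLpNorm_eq_integral_rpow_norm two_ne_zero ENNReal.ofNat_ne_top,
      ENNReal.toReal_ofReal (by positivity), ← Real.rpow_natCast, ← Real.rpow_mul]
    · norm_num
    · exact integral_nonneg fun _ => by positivity
  rw [← h3]
  gcongr

variable [IsProbabilityMeasure μ]

theorem integrable (hk : IsSmoothingWithKernel μ S k) (x : X) : Integrable (k x) μ :=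
  (hk.memLp x).integrable one_le_two

theorem integrable_mul (hk : IsSmoothingWithKernel μ S k) {f : X → ℝ} (hf : BddMeas f) (x : X) :
    Integrable (fun y => k x y * f y) μ := by
  obtain ⟨mf, C, hC⟩ := hf
  exact (hk.integrable x).mul_bdd (c := C) mf.aestronglyMeasurable (ae_of_all _ hC)

theorem integrable_mul_complex (hk : IsSmoothingWithKernel μ S k) (w : BB X) (x : X) :
    Integrable (fun y => (k x y : ℂ) * w y) μ :=
  (hk.integrable x).ofReal.mul_bdd (c := ‖w‖) w.2.aestronglyMeasurable
    (ae_of_all _ (BB.norm_apply_le w))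

theorem re_apply (hk : IsSmoothingWithKernel μ S k) (w : BB X) (x : X) :
    (S w x).re = kop μ k (fun y => (w y).re) x := by
  rw [hk.apply_eq, kop]
  have := integral_re (hk.integrable_mul_complex w x)
  simpa using this.symm

theorem im_apply (hk : IsSmoothingWithKernel μ S k) (w : BB X) (x : X) :
    (S w x).im = kop μ k (fun y => (w y).im) x := by
  rw [hk.apply_eq, kop]
  have := integral_im (hk.integrable_mul_complex w x)
  simpa using this.symm

theorem apply_ofReal (hk : IsSmoothingWithKernel μ S k) {f : X → ℝ} (hf : BddMeas f) (x : X) :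
    S (ofFun fun y => (f y : ℂ)) x = kop μ k f x := by
  apply Complex.ext
  · rw [hk.re_apply]
    simp [ofFun_apply hf.ofReal]
  · rw [hk.im_apply]
    simp [ofFun_apply hf.ofReal, kop]

theorem bddMeas_kop (hk : IsSmoothingWithKernel μ S k) {f : X → ℝ} (hf : BddMeas f) :
    BddMeas (kop μ k f) := by
  have := (S (ofFun fun y => (f y : ℂ))).bddMeas.re
  simpa only [hk.apply_ofReal hf, Complex.ofReal_re] using this

theorem kop_mono (hk : IsSmoothingWithKernel μ S k) {f g : X → ℝ} (hf : BddMeas f)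
    (hg : BddMeas g) (h : ∀ x, f x ≤ g x) (x : X) : kop μ k f x ≤ kop μ k g x :=
  integral_mono (hk.integrable_mul hf x) (hk.integrable_mul hg x)
    fun y => mul_le_mul_of_nonneg_left (h y) (hk.nonneg x y)

theorem kop_add (hk : IsSmoothingWithKernel μ S k) {f g : X → ℝ} (hf : BddMeas f)
    (hg : BddMeas g) (x : X) : kop μ k (fun y => f y + g y) x = kop μ k f x + kop μ k g x := by
  simp only [kop, mul_add]
  exact integral_add (hk.integrable_mul hf x) (hk.integrable_mul hg x)

theorem sq_kop_le (hk : IsSmoothingWithKernel μ S k) {f p q : X → ℝ} (hf : BddMeas f)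
    (hp : BddMeas p) (hq : BddMeas q) (hp0 : ∀ x, 0 ≤ p x) (hq0 : ∀ x, 0 ≤ q x)
    (h : ∀ x, f x ^ 2 ≤ p x * q x) (x : X) : kop μ k f x ^ 2 ≤ kop μ k p x * kop μ k q x := by
  refine sq_integral_le (hk.integrable_mul hf x) (hk.integrable_mul hp x) (hk.integrable_mul hq x)
    (fun y => mul_nonneg (hk.nonneg x y) (hp0 y)) (fun y => mul_nonneg (hk.nonneg x y) (hq0 y))
    fun y => ?_
  nlinarith [mul_le_mul_of_nonneg_left (h y) (sq_nonneg (k x y))]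

theorem integral_mul_kop (hk : IsSmoothingWithKernel μ S k) (hA1 : IsSymmetricPositive μ S)
    {f g : X → ℝ} (hf : BddMeas f) (hg : BddMeas g) :
    ∫ x, f x * kop μ k g x ∂μ = ∫ x, kop μ k f x * g x ∂μ := by
  have := hA1.1 (ofFun fun y => (f y : ℂ)) (ofFun fun y => (g y : ℂ))
  simp only [pairing, hk.apply_ofReal hf, hk.apply_ofReal hg, ofFun_apply hf.ofReal,
    ofFun_apply hg.ofReal, Complex.conj_ofReal, ← Complex.ofReal_mul] at this
  rw [integral_complex_ofReal, integral_complex_ofReal] at this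
  exact_mod_cast this

theorem kop_one_le (hk : IsSmoothingWithKernel μ S k) {C : ℝ} (hC1 : 1 ≤ C)
    (hC : ∀ x, ∫ y, k x y ^ 2 ∂μ ≤ C) (x : X) : kop μ k (fun _ => 1) x ≤ C := by
  have h1 : (∫ y, k x y ∂μ) ^ 2 ≤ (∫ y, k x y ^ 2 ∂μ) * ∫ _, (1 : ℝ) ∂μ :=
    sq_integral_le (hk.integrable x) (hk.memLp x).integrable_sq (integrable_const _)
      (fun _ => sq_nonneg _) (fun _ => zero_le_one) (fun _ => by simp)
  simp only [integral_const, probReal_univ, smul_eq_mul, mul_one] at h1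
  simp only [kop, mul_one]
  have := hC x
  nlinarith

/-- The kernel of `S²` is `⟨S_x, S_w⟩`, which Cauchy–Schwarz bounds by `C`. Thus `S²` maps L¹ to
bounded functions, which is what turns an L¹ bound on a solution into pointwise information. -/
theorem kop_kop_le (hk : IsSmoothingWithKernel μ S k) {C : ℝ}
    (hC : ∀ x, ∫ y, k x y ^ 2 ∂μ ≤ C) {f : X → ℝ} (hf : BddMeas f) (hf0 : ∀ x, 0 ≤ f x) (x : X) :
    kop μ k (kop μ k f) x ≤ C * ∫ y, f y ∂μ := by
  have hm : Measurable fun p : X × X => k x p.1 * (k p.1 p.2 * f p.2) := by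
    have h1 : Measurable fun p : X × X => k x p.1 := hk.measurable.of_uncurry_left.comp measurable_fst
    have h2 : Measurable fun p : X × X => k p.1 p.2 := hk.measurable
    exact h1.mul (h2.mul (hf.1.comp measurable_snd))
  have hint : Integrable (Function.uncurry fun y w => k x y * (k y w * f w)) (μ.prod μ) := by
    refine (integrable_prod_iff hm.aestronglyMeasurable).2
      ⟨ae_of_all _ fun y => (hk.integrable_mul hf y).const_mul (k x y), ?_⟩
    refine (hk.integrable_mul (hk.bddMeas_kop hf) x).congr (ae_of_all _ fun y => ?_)
    simp only [kop]
    rw [← integral_const_mul]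
    refine integral_congr_ae (ae_of_all _ fun w => ?_)
    simp only [Real.norm_eq_abs]
    rw [abs_of_nonneg (mul_nonneg (hk.nonneg _ _) (mul_nonneg (hk.nonneg _ _) (hf0 _)))]
  have h1 : kop μ k (kop μ k f) x = ∫ w, ∫ y, k x y * (k y w * f w) ∂μ ∂μ := by
    rw [← integral_integral_swap hint]
    simp only [kop, integral_const_mul]
  rw [h1, ← integral_const_mul]
  refine integral_mono hint.integral_prod_right ((hf.integrable).const_mul _) fun w => ?_
  have h2 : ∫ y, k x y * (k y w * f w) ∂μ = (∫ y, k x y * k w y ∂μ) * f w := by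
    rw [← integral_mul_const]
    refine integral_congr_ae (ae_of_all _ fun y => ?_)
    simp only [hk.symm y w, mul_assoc]
  have h3 : (∫ y, k x y * k w y ∂μ) ^ 2 ≤ (∫ y, k x y ^ 2 ∂μ) * ∫ y, k w y ^ 2 ∂μ :=
    sq_integral_le ((hk.memLp x).integrable_mul (hk.memLp w)) (hk.memLp x).integrable_sq
      (hk.memLp w).integrable_sq (fun _ => sq_nonneg _) (fun _ => sq_nonneg _)
      (fun y => by rw [mul_pow])
  have h0 : 0 ≤ ∫ y, k x y ^ 2 ∂μ := integral_nonneg fun _ => sq_nonneg _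
  have h4 : (∫ y, k x y ^ 2 ∂μ) * ∫ y, k w y ^ 2 ∂μ ≤ C * C :=
    mul_le_mul (hC x) (hC w) (integral_nonneg fun _ => sq_nonneg _) (h0.trans (hC x))
  have h5 : ∫ y, k x y * k w y ∂μ ≤ C :=
    abs_le_of_sq_le_sq' (by nlinarith) (h0.trans (hC x)) |>.2
  simp only [h2]
  exact mul_le_mul_of_nonneg_right h5 (hf0 w)

end IsSmoothingWithKernel

end Kernel

/-! ### Existence and uniqueness by hyperbolic contraction -/

section Existence

variable {X : Type*} [MeasurableSpace X]

/-- `u` solves the quadratic vector equation at the spectral parameter `z`. -/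
def IsSolutionAt (S : BB X →L[ℂ] BB X) (a : BB X) (z : ℂ) (u : BB X) : Prop :=
  ∀ x, 0 < (u x).im ∧ -(1 / u x) = z + a x + S u x

/-- The map `u ↦ -1 / (z + a + S u)`, whose fixed points solve the quadratic vector equation. -/
noncomputable def qveMap (S : BB X →L[ℂ] BB X) (a : BB X) (z : ℂ) (u : BB X) : BB X :=
  ofFun fun x => -(z + a x + S u x)⁻¹

variable {μ : Measure X} [IsProbabilityMeasure μ] {S : BB X →L[ℂ] BB X} {k : X → X → ℝ}
  {a : BB X} {z : ℂ} {u w : BB X}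

theorem im_denom (hk : IsSmoothingWithKernel μ S k) (ha : IsRealValued a) (x : X) :
    (z + a x + S u x).im = z.im + kop μ k (fun y => (u y).im) x := by
  simp [hk.im_apply, ha x]

theorem le_im_denom (hk : IsSmoothingWithKernel μ S k) (ha : IsRealValued a)
    (hu : ∀ x, 0 ≤ (u x).im) (x : X) : z.im ≤ (z + a x + S u x).im := by
  rw [im_denom hk ha]
  linarith [kop_nonneg hk hu x]

theorem le_norm_denom (hk : IsSmoothingWithKernel μ S k) (ha : IsRealValued a)
    (hu : ∀ x, 0 ≤ (u x).im) (x : X) : z.im ≤ ‖z + a x + S u x‖ :=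
  (le_im_denom hk ha hu x).trans (Complex.im_le_norm _)

theorem norm_denom_le (x : X) : ‖z + a x + S u x‖ ≤ ‖z‖ + ‖a‖ + ‖S‖ * ‖u‖ := by
  refine (norm_add₃_le).trans ?_
  gcongr
  · exact BB.norm_apply_le a x
  · exact (BB.norm_apply_le _ x).trans (S.le_opNorm u)

theorem qveMap_apply (hk : IsSmoothingWithKernel μ S k) (ha : IsRealValued a) (hz : 0 < z.im)
    (hu : ∀ x, 0 ≤ (u x).im) (x : X) : qveMap S a z u x = -(z + a x + S u x)⁻¹ := by
  have h : BddMeas fun x => z + a x + S u x :=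
    ((BddMeas.const z).add a.bddMeas).add (S u).bddMeas
  have h2 := (BddMeas.const (0 : ℂ)).sub (h.inv hz (le_norm_denom hk ha hu))
  simp only [zero_sub] at h2
  exact ofFun_apply h2 x

theorem im_qveMap (hk : IsSmoothingWithKernel μ S k) (ha : IsRealValued a) (hz : 0 < z.im)
    (hu : ∀ x, 0 ≤ (u x).im) (x : X) :
    (qveMap S a z u x).im = (z + a x + S u x).im / ‖z + a x + S u x‖ ^ 2 := by
  rw [qveMap_apply hk ha hz hu, Complex.neg_im, Complex.inv_im, Complex.normSq_eq_norm_sq]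
  ring

theorem norm_qveMap_le (hk : IsSmoothingWithKernel μ S k) (ha : IsRealValued a) (hz : 0 < z.im)
    (hu : ∀ x, 0 ≤ (u x).im) : ‖qveMap S a z u‖ ≤ z.im⁻¹ := by
  refine BB.norm_le (inv_nonneg.2 hz.le) fun x => ?_
  rw [qveMap_apply hk ha hz hu, norm_neg, norm_inv]
  exact inv_anti₀ hz (le_norm_denom hk ha hu x)

theorem le_im_qveMap (hk : IsSmoothingWithKernel μ S k) (ha : IsRealValued a) (hz : 0 < z.im)
    (hu : ∀ x, 0 ≤ (u x).im) (hu' : ‖u‖ ≤ z.im⁻¹) (x : X) :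
    z.im / (‖z‖ + ‖a‖ + ‖S‖ * z.im⁻¹) ^ 2 ≤ (qveMap S a z u x).im := by
  rw [im_qveMap hk ha hz hu]
  have h1 := le_norm_denom hk ha hu (z := z) x
  have h2 : ‖z + a x + S u x‖ ≤ ‖z‖ + ‖a‖ + ‖S‖ * z.im⁻¹ := by
    refine (norm_denom_le x).trans ?_
    gcongr
  have h3 : 0 < ‖z + a x + S u x‖ := hz.trans_le h1
  have h4 := le_im_denom hk ha hu (z := z) x
  have h5 := hz.le.trans h4
  gcongr

/-- The right side asks only for `Im u ≥ 0`, a closed condition that survives limits of iterates;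
strict positivity is automatic for a fixed point because `Im z > 0`. -/
theorem isSolutionAt_iff (hk : IsSmoothingWithKernel μ S k) (ha : IsRealValued a)
    (hz : 0 < z.im) : IsSolutionAt S a z u ↔ (∀ x, 0 ≤ (u x).im) ∧ qveMap S a z u = u := by
  constructor
  · intro h
    refine ⟨fun x => (h x).1.le, BB.ext fun x => ?_⟩
    rw [qveMap_apply hk ha hz fun x => (h x).1.le, ← (h x).2]
    simp
  · rintro ⟨h0, h⟩ x
    have h1 : u x = -(z + a x + S u x)⁻¹ := by
      rw [← qveMap_apply hk ha hz h0, h]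
    have h2 := le_im_denom hk ha h0 (z := z) x
    have h3 := le_norm_denom hk ha h0 (z := z) x
    refine ⟨?_, ?_⟩
    · rw [← h, im_qveMap hk ha hz h0]
      have := hz.trans_le h3
      have := hz.trans_le h2
      positivity
    · conv_lhs => rw [h1]
      simp

/-- The contraction property of `qveMap` in the hyperbolic metric. -/
theorem qveMap_contraction (hk : IsSmoothingWithKernel μ S k) (ha : IsRealValued a)
    (hz : 0 < z.im) (hu : ∀ x, 0 ≤ (u x).im) (hw : ∀ x, 0 ≤ (w x).im)
    (hu' : ‖u‖ ≤ z.im⁻¹) (hw' : ‖w‖ ≤ z.im⁻¹) {d : ℝ}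
    (h : ∀ x, ‖u x - w x‖ ^ 2 ≤ d ^ 2 * (u x).im * (w x).im) (x : X) :
    ‖qveMap S a z u x - qveMap S a z w x‖ ^ 2 ≤
      (‖S‖ * z.im⁻¹ / (‖S‖ * z.im⁻¹ + z.im) * d) ^ 2 * (qveMap S a z u x).im *
        (qveMap S a z w x).im := by
  rw [im_qveMap hk ha hz hu, im_qveMap hk ha hz hw, qveMap_apply hk ha hz hu,
    qveMap_apply hk ha hz hw]
  have hα := le_norm_denom hk ha hu (z := z) x
  have hβ := le_norm_denom hk ha hw (z := z) x
  have hsub : (z + a x + S u x) - (z + a x + S w x) = S (u - w) x := by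
    rw [S.map_sub u w, BB.sub_apply]; ring
  have hmain : ‖S (u - w) x‖ ^ 2 ≤
      d ^ 2 * kop μ k (fun y => (u y).im) x * kop μ k (fun y => (w y).im) x := by
    refine (pow_le_pow_left₀ (norm_nonneg _) (hk.norm_apply_le (u - w) x) 2).trans ?_
    rw [← kop_const_mul (d ^ 2) (fun y => (u y).im) x]
    refine hk.sq_kop_le (u - w).bddMeas.norm ((BddMeas.const _).mul u.bddMeas.im) w.bddMeas.im
      (fun y => mul_nonneg (sq_nonneg _) (hu y)) hw (fun y => ?_) x
    exact h y
  -- The contraction factor: `S Im v` is at most `‖S‖/Im z`, the denominator has imaginary part `Im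
  -- z + S Im v`, and `t/(t + Im z)` increases in `t`.
  have bound : ∀ v : BB X, (∀ x, 0 ≤ (v x).im) → ‖v‖ ≤ z.im⁻¹ →
      0 ≤ kop μ k (fun y => (v y).im) x ∧ kop μ k (fun y => (v y).im) x ≤
        ‖S‖ * z.im⁻¹ / (‖S‖ * z.im⁻¹ + z.im) * (z + a x + S v x).im := by
    intro v hv hv'
    have h0 := kop_nonneg hk hv x
    have h1 : kop μ k (fun y => (v y).im) x ≤ ‖S‖ * z.im⁻¹ := by
      rw [← hk.im_apply]
      refine (Complex.im_le_norm _).trans ((BB.norm_apply_le _ x).trans ((S.le_opNorm v).trans ?_))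
      gcongr
    refine ⟨h0, ?_⟩
    rw [im_denom hk ha, div_mul_eq_mul_div, le_div_iff₀ (by positivity)]
    nlinarith
  obtain ⟨hA0, hA⟩ := bound u hu hu'
  obtain ⟨hB0, hB⟩ := bound w hw hw'
  set α := z + a x + S u x with hαdef
  set β := z + a x + S w x with hβdef
  set θ := ‖S‖ * z.im⁻¹ / (‖S‖ * z.im⁻¹ + z.im)
  have hα0 : 0 < ‖α‖ := hz.trans_le hα
  have hβ0 : 0 < ‖β‖ := hz.trans_le hβ
  have e : -α⁻¹ - -β⁻¹ = (α - β) / (α * β) := by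
    have := norm_pos_iff.1 hα0
    have := norm_pos_iff.1 hβ0
    field_simp
    ring
  rw [e, hsub, norm_div, norm_mul, div_pow, mul_pow]
  have h3 : ‖S (u - w) x‖ ^ 2 ≤ (θ * d) ^ 2 * α.im * β.im := by
    refine hmain.trans ?_
    have := mul_le_mul hA hB hB0 (hA0.trans hA)
    nlinarith [mul_le_mul_of_nonneg_left this (sq_nonneg d)]
  rw [div_le_iff₀ (by positivity)]
  refine h3.trans (le_of_eq ?_)
  field_simp

/-- The geometric decay of the distance of two orbits of `qveMap`. -/
theorem norm_iterate_sub_le (hk : IsSmoothingWithKernel μ S k) (ha : IsRealValued a)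
    (hz : 0 < z.im) : ∃ C θ : ℝ, 0 ≤ θ ∧ θ < 1 ∧ ∀ u w : BB X, (∀ x, 0 ≤ (u x).im) →
      (∀ x, 0 ≤ (w x).im) → ‖u‖ ≤ z.im⁻¹ → ‖w‖ ≤ z.im⁻¹ →
      ∀ n, ‖(qveMap S a z)^[n + 1] u - (qveMap S a z)^[n + 1] w‖ ≤ C * θ ^ n := by
  set M := ‖z‖ + ‖a‖ + ‖S‖ * z.im⁻¹ with hM
  have hz' : 0 < ‖z‖ := hz.trans_le (Complex.im_le_norm z)
  have hM0 : 0 < M := by positivity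
  set c := z.im / M ^ 2 with hc
  have hc0 : 0 < c := by positivity
  set θ := ‖S‖ * z.im⁻¹ / (‖S‖ * z.im⁻¹ + z.im) with hθ
  have hθ0 : 0 ≤ θ := by positivity
  have hθ1 : θ < 1 := by
    rw [hθ, div_lt_one (by positivity)]
    linarith
  -- After one step both orbits have norm at most `1/Im z` and imaginary part at least `c`, so `d`
  -- bounds their initial hyperbolic distance.
  set d := 2 * z.im⁻¹ / c with hd
  have hd0 : 0 ≤ d := by positivity
  have inv : ∀ u : BB X, (∀ x, 0 ≤ (u x).im) → ‖u‖ ≤ z.im⁻¹ → ∀ n,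
      (∀ x, c ≤ ((qveMap S a z)^[n + 1] u x).im) ∧ ‖(qveMap S a z)^[n + 1] u‖ ≤ z.im⁻¹ := by
    intro u hu hu' n
    induction n with
    | zero => exact ⟨le_im_qveMap hk ha hz hu hu', norm_qveMap_le hk ha hz hu⟩
    | succ n ih =>
      rw [Function.iterate_succ_apply']
      have h0 : ∀ x, 0 ≤ ((qveMap S a z)^[n + 1] u x).im := fun x => hc0.le.trans (ih.1 x)
      exact ⟨le_im_qveMap hk ha hz h0 ih.2, norm_qveMap_le hk ha hz h0⟩
  refine ⟨d * z.im⁻¹, θ, hθ0, hθ1, fun u w hu hw hu' hw' => ?_⟩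
  have key : ∀ n x, ‖(qveMap S a z)^[n + 1] u x - (qveMap S a z)^[n + 1] w x‖ ^ 2 ≤
      (θ ^ n * d) ^ 2 * ((qveMap S a z)^[n + 1] u x).im * ((qveMap S a z)^[n + 1] w x).im := by
    intro n
    induction n with
    | zero =>
      intro x
      obtain ⟨h1, h2⟩ := inv u hu hu' 0
      obtain ⟨h3, h4⟩ := inv w hw hw' 0
      have h5 : ‖(qveMap S a z)^[0 + 1] u x - (qveMap S a z)^[0 + 1] w x‖ ≤ d * c := by
        rw [hd, div_mul_cancel₀ _ hc0.ne', two_mul]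
        exact norm_sub_le_of_le ((BB.norm_apply_le _ x).trans h2)
          ((BB.norm_apply_le _ x).trans h4)
      rw [pow_zero, one_mul]
      calc _ ≤ (d * c) ^ 2 := pow_le_pow_left₀ (norm_nonneg _) h5 2
        _ = d ^ 2 * c * c := by ring
        _ ≤ _ := by
          have e1 := h1 x
          have e3 := h3 x
          have e2 := hc0.le.trans e1
          gcongr
    | succ n ih =>
      intro x
      obtain ⟨h1, h2⟩ := inv u hu hu' n
      obtain ⟨h3, h4⟩ := inv w hw hw' n
      have := qveMap_contraction hk ha hz (fun x => hc0.le.trans (h1 x))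
        (fun x => hc0.le.trans (h3 x)) h2 h4 ih x
      rw [Function.iterate_succ_apply' _ (n + 1), Function.iterate_succ_apply' _ (n + 1)]
      refine this.trans (le_of_eq ?_)
      rw [← hθ]
      ring
  intro n
  refine BB.norm_le (by positivity) fun x => ?_
  obtain ⟨h1, h2⟩ := inv u hu hu' n
  obtain ⟨h3, h4⟩ := inv w hw hw' n
  have b1 : ((qveMap S a z)^[n + 1] u x).im ≤ z.im⁻¹ :=
    (Complex.im_le_norm _).trans ((BB.norm_apply_le _ x).trans h2)
  have b2 : ((qveMap S a z)^[n + 1] w x).im ≤ z.im⁻¹ :=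
    (Complex.im_le_norm _).trans ((BB.norm_apply_le _ x).trans h4)
  have b3 := hc0.le.trans (h1 x)
  have b4 := hc0.le.trans (h3 x)
  rw [BB.sub_apply]
  refine le_of_sq_le_sq ((key n x).trans ?_) (by positivity)
  calc _ ≤ (θ ^ n * d) ^ 2 * z.im⁻¹ * z.im⁻¹ := by gcongr
    _ = _ := by ring

theorem IsSolutionAt.unique (hk : IsSmoothingWithKernel μ S k) (ha : IsRealValued a)
    (hz : 0 < z.im) (hu : IsSolutionAt S a z u) (hw : IsSolutionAt S a z w) : u = w := by
  obtain ⟨C, θ, hθ0, hθ1, h⟩ := norm_iterate_sub_le (S := S) (a := a) hk ha hz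
  obtain ⟨hu0, hu1⟩ := (isSolutionAt_iff hk ha hz).1 hu
  obtain ⟨hw0, hw1⟩ := (isSolutionAt_iff hk ha hz).1 hw
  have hn : ∀ n, ‖u - w‖ ≤ C * θ ^ n := by
    intro n
    have := h u w hu0 hw0 (by rw [← hu1]; exact norm_qveMap_le hk ha hz hu0)
      (by rw [← hw1]; exact norm_qveMap_le hk ha hz hw0) n
    rwa [Function.iterate_fixed hu1, Function.iterate_fixed hw1] at this
  have h0 : Tendsto (fun n : ℕ => C * θ ^ n) atTop (𝓝 0) := by
    simpa using (tendsto_pow_atTop_nhds_zero_of_lt_one hθ0 hθ1).const_mul C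
  exact sub_eq_zero.1 (norm_le_zero_iff.1 (ge_of_tendsto' h0 hn))

theorem exists_isSolutionAt (hk : IsSmoothingWithKernel μ S k) (ha : IsRealValued a)
    (hz : 0 < z.im) : ∃ u, IsSolutionAt S a z u := by
  obtain ⟨C, θ, hθ0, hθ1, h⟩ := norm_iterate_sub_le (S := S) (a := a) hk ha hz
  set Φ := qveMap S a z with hΦ
  set f : ℕ → BB X := fun n => Φ^[n + 1] 0 with hf
  have z0 : ∀ x, 0 ≤ ((0 : BB X) x).im := fun x => by simp
  have z1 : ‖(0 : BB X)‖ ≤ z.im⁻¹ := by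
    rw [norm_zero]
    exact inv_nonneg.2 hz.le
  have f0 : ∀ n, ∀ x, 0 ≤ (f n x).im := by
    intro n
    induction n with
    | zero =>
      intro x
      exact le_trans (by positivity) (le_im_qveMap hk ha hz z0 z1 x)
    | succ n ih =>
      intro x
      rw [hf]
      simp only [Function.iterate_succ_apply' _ (n + 1)]
      have hden := hz.trans_le (le_im_denom hk ha ih (z := z) x)
      refine le_trans ?_ (im_qveMap hk ha hz ih x).ge
      positivity
  have hcauchy : CauchySeq f := by
    refine cauchySeq_of_le_geometric θ C hθ1 fun n => ?_
    rw [dist_eq_norm]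
    -- Comparing the orbits started at `0` and at `Φ 0` estimates consecutive terms of the single
    -- orbit `f`.
    have := h 0 (Φ 0) z0 (f0 0) z1 (norm_qveMap_le hk ha hz z0) n
    rwa [← Function.iterate_succ_apply] at this
  obtain ⟨u, hu⟩ := cauchySeq_tendsto_of_complete hcauchy
  have hpt : ∀ v : ℕ → BB X, ∀ v' : BB X, Tendsto v atTop (𝓝 v') →
      ∀ x, Tendsto (fun n => v n x) atTop (𝓝 (v' x)) := by
    intro v v' hv x
    rw [tendsto_iff_norm_sub_tendsto_zero] at hv ⊢
    exact squeeze_zero (fun _ => norm_nonneg _) (fun n => BB.norm_apply_le (v n - v') x) hv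
  have u0 : ∀ x, 0 ≤ (u x).im := fun x =>
    ge_of_tendsto' ((Complex.continuous_im.tendsto _).comp (hpt f u hu x)) fun n => f0 n x
  refine ⟨u, (isSolutionAt_iff hk ha hz).2 ⟨u0, BB.ext fun x => ?_⟩⟩
  have h1 : Tendsto (fun n => f (n + 1) x) atTop (𝓝 (u x)) :=
    hpt _ _ ((tendsto_add_atTop_iff_nat 1).2 hu) x
  have h2 : Tendsto (fun n => f (n + 1) x) atTop (𝓝 (Φ u x)) := by
    have e : ∀ n, f (n + 1) x = -(z + a x + S (f n) x)⁻¹ := by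
      intro n
      rw [← qveMap_apply hk ha hz (f0 n)]
      simp only [hf, Function.iterate_succ_apply' _ (n + 1), hΦ]
    rw [show Φ u x = _ from qveMap_apply hk ha hz u0 x]
    have hne : z + a x + S u x ≠ 0 :=
      norm_pos_iff.1 (hz.trans_le (le_norm_denom hk ha u0 x))
    have h3 : Tendsto (fun n => S (f n)) atTop (𝓝 (S u)) := (S.continuous.tendsto u).comp hu
    exact (((tendsto_const_nhds.add (hpt _ _ h3 x)).inv₀ hne).neg).congr fun n => (e n).symm
  exact tendsto_nhds_unique h2 h1

theorem existsUnique_isSolution (hk : IsSmoothingWithKernel μ S k) (ha : IsRealValued a) :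
    ∃! m : ℍ → BB X, IsSolution S a m := by
  choose m hm using fun z : ℍ => exists_isSolutionAt (S := S) (a := a) hk ha z.im_pos
  exact ⟨m, hm, fun m' hm' => funext fun z =>
    IsSolutionAt.unique hk ha z.im_pos (hm' z) (hm z)⟩

end Existence

/-! ### A priori L² bounds, and the passage from L² to sup -/

section SolutionBounds

variable {X : Type*} [MeasurableSpace X] {μ : Measure X}
  {S : BB X →L[ℂ] BB X} {k : X → X → ℝ} {a : BB X} {z : ℂ} {u : BB X}

namespace IsSolutionAt

theorem apply_ne_zero (hu : IsSolutionAt S a z u) (x : X) : u x ≠ 0 := by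
  intro h
  have := (hu x).1
  rw [h] at this
  simp at this

theorem norm_pos (hu : IsSolutionAt S a z u) (x : X) : 0 < ‖u x‖ :=
  norm_pos_iff.2 (hu.apply_ne_zero x)

theorem inv_norm_eq (hu : IsSolutionAt S a z u) (x : X) : ‖u x‖⁻¹ = ‖z + a x + S u x‖ := by
  rw [← (hu x).2, norm_neg, norm_div, norm_one, one_div]

/-- Solve the equation for `z`, apply the triangle inequality and multiply by `|u|`. Since `|u|
S|u|` is bounded in L², this controls `|u|` in L² once `|z| > ‖a‖`. -/
theorem norm_mul_norm_add_le (hu : IsSolutionAt S a z u) (hk : IsSmoothingWithKernel μ S k)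
    (x : X) : (‖z‖ - ‖a‖) * ‖u x‖ ≤ 1 + ‖u x‖ * kop μ k (fun y => ‖u y‖) x := by
  have h1 := hu.inv_norm_eq x
  have h0 := hu.norm_pos x
  have h2 : ‖z‖ ≤ ‖z + a x + S u x‖ + ‖a‖ + kop μ k (fun y => ‖u y‖) x := by
    have e : z = (z + a x + S u x) - a x - S u x := by ring
    calc ‖z‖ = ‖(z + a x + S u x) - a x - S u x‖ := by rw [← e]
      _ ≤ ‖z + a x + S u x‖ + ‖a x‖ + ‖S u x‖ :=
        (norm_sub_le _ _).trans (add_le_add_left (norm_sub_le _ _) _)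
      _ ≤ _ := by
        gcongr
        · exact BB.norm_apply_le a x
        · exact hk.norm_apply_le u x
  rw [← h1] at h2
  have h3 := mul_le_mul_of_nonneg_left h2 h0.le
  have h4 : ‖u x‖ * ‖u x‖⁻¹ = 1 := mul_inv_cancel₀ h0.ne'
  linarith

end IsSolutionAt

variable [IsProbabilityMeasure μ]

theorem BddMeas.integrable_mul_mul {f g : X → ℝ} (hf : BddMeas f) (hg : BddMeas g) :
    Integrable (fun x => f x * g x) μ :=
  (hf.mul hg).integrable

namespace IsSolutionAt

/-- The constant degenerates as `Im z → 0`; it serves only to make quotients by `Im u` or `|u|`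
bounded, hence integrable, and never enters a final bound. -/
theorem exists_le_im (hu : IsSolutionAt S a z u) (hk : IsSmoothingWithKernel μ S k)
    (ha : IsRealValued a) (hz : 0 < z.im) : ∃ c : ℝ, 0 < c ∧ ∀ x, c ≤ (u x).im := by
  obtain ⟨h0, h1⟩ := (isSolutionAt_iff hk ha hz).1 hu
  have hz' : 0 < ‖z‖ := hz.trans_le (Complex.im_le_norm z)
  refine ⟨z.im / (‖z‖ + ‖a‖ + ‖S‖ * z.im⁻¹) ^ 2, by positivity, fun x => ?_⟩
  have h2 : ‖u‖ ≤ z.im⁻¹ := by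
    conv_lhs => rw [← h1]
    exact norm_qveMap_le hk ha hz h0
  have h3 := le_im_qveMap hk ha hz h0 h2 x
  rwa [h1] at h3

theorem im_eq (hu : IsSolutionAt S a z u) (hk : IsSmoothingWithKernel μ S k)
    (ha : IsRealValued a) (x : X) :
    (u x).im = ‖u x‖ ^ 2 * (z.im + kop μ k (fun y => (u y).im) x) := by
  rw [← im_denom hk ha, ← (hu x).2]
  have := hu.norm_pos x
  rw [one_div, Complex.neg_im, Complex.inv_im, Complex.normSq_eq_norm_sq]
  field_simp

theorem sq_norm_mul_kop_im_le (hu : IsSolutionAt S a z u) (hk : IsSmoothingWithKernel μ S k)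
    (ha : IsRealValued a) (hz : 0 < z.im) (x : X) :
    ‖u x‖ ^ 2 * kop μ k (fun y => (u y).im) x ≤ (u x).im := by
  have h1 := hu.im_eq hk ha x
  have h2 : 0 ≤ ‖u x‖ ^ 2 * z.im := by positivity
  linarith

/-- The operator `|m| S |m|` applied to `1` has `L²`-norm at most `1`. -/
theorem integral_sq_mul_kop_le (hu : IsSolutionAt S a z u) (hk : IsSmoothingWithKernel μ S k)
    (hA1 : IsSymmetricPositive μ S) (ha : IsRealValued a) (hz : 0 < z.im) :
    ∫ x, (‖u x‖ * kop μ k (fun y => ‖u y‖) x) ^ 2 ∂μ ≤ 1 := by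
  obtain ⟨c, hc, hcu⟩ := hu.exists_le_im hk ha hz
  have hr := u.bddMeas.norm
  have hv := u.bddMeas.im
  have hg : BddMeas fun x => ‖u x‖ ^ 2 * ((u x).im)⁻¹ :=
    hr.pow_two.mul (hv.inv hc fun x => (hcu x).trans (le_abs_self _))
  -- Schur test with weight `Im u`: split `|u|² = Im u · (|u|²/Im u)` in Cauchy–Schwarz and use
  -- `|u|² S Im u ≤ Im u`. Symmetry of `S` then moves it back onto `Im u`, where the same inequality
  -- applies again.
  have h1 : ∀ x, (‖u x‖ * kop μ k (fun y => ‖u y‖) x) ^ 2 ≤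
      (u x).im * kop μ k (fun y => ‖u y‖ ^ 2 * ((u y).im)⁻¹) x := by
    intro x
    have e1 := hk.sq_kop_le hr hv hg (fun y => (hu y).1.le)
      (fun y => mul_nonneg (sq_nonneg _) (inv_nonneg.2 (hu y).1.le)) (fun y => by
        have := (hu y).1.ne'
        apply le_of_eq
        field_simp) x
    have e2 := hu.sq_norm_mul_kop_im_le hk ha hz x
    have e3 : 0 ≤ kop μ k (fun y => ‖u y‖ ^ 2 * ((u y).im)⁻¹) x :=
      kop_nonneg hk (fun y => mul_nonneg (sq_nonneg _) (inv_nonneg.2 (hu y).1.le)) x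
    rw [mul_pow]
    calc _ ≤ ‖u x‖ ^ 2 * (kop μ k (fun y => (u y).im) x *
          kop μ k (fun y => ‖u y‖ ^ 2 * ((u y).im)⁻¹) x) :=
          mul_le_mul_of_nonneg_left e1 (sq_nonneg _)
      _ ≤ _ := by
        rw [← mul_assoc]
        exact mul_le_mul_of_nonneg_right e2 e3
  have hTv := hk.bddMeas_kop hv
  calc _ ≤ ∫ x, (u x).im * kop μ k (fun y => ‖u y‖ ^ 2 * ((u y).im)⁻¹) x ∂μ :=
        integral_mono (hr.mul (hk.bddMeas_kop hr)).pow_two.integrable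
          (hv.integrable_mul_mul (hk.bddMeas_kop hg)) h1
    _ = ∫ x, kop μ k (fun y => (u y).im) x * (‖u x‖ ^ 2 * ((u x).im)⁻¹) ∂μ :=
        hk.integral_mul_kop hA1 hv hg
    _ ≤ ∫ _, (1 : ℝ) ∂μ := by
        refine integral_mono (hTv.integrable_mul_mul hg) (integrable_const _) fun x => ?_
        have := hu.sq_norm_mul_kop_im_le hk ha hz x
        have h0 := (hu x).1
        calc _ = ‖u x‖ ^ 2 * kop μ k (fun y => (u y).im) x / (u x).im := by ring
          _ ≤ 1 := (div_le_one h0).2 this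
    _ = 1 := by simp

theorem integral_mul_kop_le (hu : IsSolutionAt S a z u) (hk : IsSmoothingWithKernel μ S k)
    (hA1 : IsSymmetricPositive μ S) (ha : IsRealValued a) (hz : 0 < z.im) :
    ∫ x, ‖u x‖ * kop μ k (fun y => ‖u y‖) x ∂μ ≤ 1 := by
  have hr := u.bddMeas.norm
  have hF := hr.mul (hk.bddMeas_kop hr)
  have h1 := sq_integral_le (μ := μ) hF.integrable hF.pow_two.integrable (integrable_const 1)
    (fun _ => sq_nonneg _) (fun _ => zero_le_one) (fun _ => by simp)
  simp only [integral_const, probReal_univ, smul_eq_mul, mul_one] at h1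
  have h2 := h1.trans (hu.integral_sq_mul_kop_le hk hA1 ha hz)
  exact (abs_le_one_iff_mul_self_le_one.2 (by rwa [← sq])) |> (le_abs_self _).trans

/-- The `L²`-bound away from the range of `-a`. -/
theorem sq_mul_integral_sq_le (hu : IsSolutionAt S a z u) (hk : IsSmoothingWithKernel μ S k)
    (hA1 : IsSymmetricPositive μ S) (ha : IsRealValued a) (hz : 0 < z.im) (hza : ‖a‖ ≤ ‖z‖) :
    (‖z‖ - ‖a‖) ^ 2 * ∫ x, ‖u x‖ ^ 2 ∂μ ≤ 4 := by
  have hr := u.bddMeas.norm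
  have hF := (hr.mul (hk.bddMeas_kop hr)).pow_two
  have h1 := hu.integral_sq_mul_kop_le hk hA1 ha hz
  rw [← integral_const_mul]
  calc _ ≤ ∫ x, (2 + 2 * (‖u x‖ * kop μ k (fun y => ‖u y‖) x) ^ 2) ∂μ := by
        refine integral_mono (hr.pow_two.integrable.const_mul _)
          ((integrable_const _).add (hF.integrable.const_mul _)) fun x => ?_
        have h2 := hu.norm_mul_norm_add_le hk x
        have h3 : 0 ≤ (‖z‖ - ‖a‖) * ‖u x‖ := mul_nonneg (sub_nonneg.2 hza) (norm_nonneg _)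
        have h4 := pow_le_pow_left₀ h3 h2 2
        simp only
        nlinarith [sq_nonneg (1 - ‖u x‖ * kop μ k (fun y => ‖u y‖) x)]
    _ = 2 + 2 * ∫ x, (‖u x‖ * kop μ k (fun y => ‖u y‖) x) ^ 2 ∂μ := by
        rw [integral_add (integrable_const _) (hF.integrable.const_mul _), integral_const_mul]
        simp
    _ ≤ 4 := by linarith

/-- An `L¹`-bound implies an `L²`-bound. -/
theorem integral_sq_le (hu : IsSolutionAt S a z u) (hk : IsSmoothingWithKernel μ S k)
    (hA1 : IsSymmetricPositive μ S) (ha : IsRealValued a) (hz : 0 < z.im) {C κ R C₁ : ℝ}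
    (hC1 : 1 ≤ C) (hC : ∀ x, ∫ y, k x y ^ 2 ∂μ ≤ C) (hκ : 0 < κ)
    (hκ' : ∀ x, κ ≤ kop μ k (fun _ => 1) x) (hR : ‖z‖ ≤ R) (h1 : ∫ x, ‖u x‖ ∂μ ≤ C₁) :
    ∫ x, ‖u x‖ ^ 2 ∂μ ≤ (((R + ‖a‖) * C + C * C₁) / κ ^ 2) ^ 2 := by
  obtain ⟨c, hc, hcu⟩ := hu.exists_le_im hk ha hz
  have hr := u.bddMeas.norm
  have hri : BddMeas fun x => ‖u x‖⁻¹ := hr.inv hc fun x => by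
    rw [Real.norm_of_nonneg (norm_nonneg _)]
    exact (hcu x).trans (Complex.im_le_norm _)
  set D := (R + ‖a‖) * C + C * C₁ with hD
  have hpos : 0 ≤ ∫ x, ‖u x‖ ∂μ := integral_nonneg fun _ => norm_nonneg _
  have hR0 : 0 ≤ R := (norm_nonneg z).trans hR
  -- By the equation `1/|u| ≤ |z| + ‖a‖ + S|u|`; applying `S` leaves `S²|u|`, which the L¹ norm
  -- controls.
  have h2 : ∀ x, kop μ k (fun y => ‖u y‖⁻¹) x ≤ D := by
    intro x
    have hTr := hk.bddMeas_kop hr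
    calc _ ≤ kop μ k (fun y => (R + ‖a‖) * 1 + kop μ k (fun y => ‖u y‖) y) x := by
          refine hk.kop_mono hri ((BddMeas.const _).add hTr) (fun y => ?_) x
          rw [hu.inv_norm_eq, mul_one]
          exact norm_add₃_le.trans
            (add_le_add (add_le_add hR (BB.norm_apply_le a y)) (hk.norm_apply_le u y))
      _ = (R + ‖a‖) * kop μ k (fun _ => 1) x + kop μ k (kop μ k fun y => ‖u y‖) x := by
          rw [hk.kop_add (BddMeas.const _) hTr, kop_const_mul]
      _ ≤ (R + ‖a‖) * C + C * ∫ x, ‖u x‖ ∂μ :=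
          add_le_add (mul_le_mul_of_nonneg_left (hk.kop_one_le hC1 hC x) (by positivity))
            (hk.kop_kop_le hC hr (fun _ => norm_nonneg _) x)
      _ ≤ D := by
          rw [hD]
          gcongr
  -- Cauchy–Schwarz with `1 = |u| · |u|⁻¹` turns the upper bound on `S|u|⁻¹` into a lower bound on
  -- `S|u|`. Then `|u|` is at most a multiple of `|u| S|u|`, whose L² norm is at most one.
  have h3 : ∀ x, κ ^ 2 ≤ kop μ k (fun y => ‖u y‖) x * D := by
    intro x
    have := hk.sq_kop_le (BddMeas.const 1) hr hri (fun _ => norm_nonneg _)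
      (fun _ => inv_nonneg.2 (norm_nonneg _))
      (fun y => by rw [mul_inv_cancel₀ (hu.norm_pos y).ne', one_pow]) x
    calc _ ≤ kop μ k (fun _ => 1) x ^ 2 := pow_le_pow_left₀ hκ.le (hκ' x) 2
      _ ≤ _ := this
      _ ≤ _ := mul_le_mul_of_nonneg_left (h2 x) (kop_nonneg hk (fun _ => norm_nonneg _) x)
  have h4 := hu.integral_sq_mul_kop_le hk hA1 ha hz
  have h5 : ∀ x, ‖u x‖ ^ 2 ≤ (D / κ ^ 2) ^ 2 * (‖u x‖ * kop μ k (fun y => ‖u y‖) x) ^ 2 := by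
    intro x
    have e : 1 ≤ D / κ ^ 2 * kop μ k (fun y => ‖u y‖) x := by
      rw [div_mul_eq_mul_div, one_le_div (by positivity), mul_comm]
      exact h3 x
    have : ‖u x‖ ≤ D / κ ^ 2 * kop μ k (fun y => ‖u y‖) x * ‖u x‖ :=
      le_mul_of_one_le_left (norm_nonneg _) e
    calc _ ≤ (D / κ ^ 2 * kop μ k (fun y => ‖u y‖) x * ‖u x‖) ^ 2 :=
          pow_le_pow_left₀ (norm_nonneg _) this 2
      _ = _ := by ring
  calc _ ≤ ∫ x, (D / κ ^ 2) ^ 2 * (‖u x‖ * kop μ k (fun y => ‖u y‖) x) ^ 2 ∂μ :=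
        integral_mono hr.pow_two.integrable
          ((hr.mul (hk.bddMeas_kop hr)).pow_two.integrable.const_mul _) h5
    _ ≤ _ := by
        rw [integral_const_mul]
        exact mul_le_of_le_one_right (sq_nonneg _) h4

end IsSolutionAt

/-- In the absence of outliers an `L²`-bound on solutions implies a uniform bound. -/
theorem NoOutliers.exists_bound (hOut : NoOutliers μ k a) (hk : IsSmoothingWithKernel μ S k)
    (Λ : ℝ) : ∃ C : ℝ, ∀ (z : ℂ) (u : BB X), IsSolutionAt S a z u →
      ∫ x, ‖u x‖ ^ 2 ∂μ ≤ Λ → ‖u‖ ≤ C := by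
  set Λ' := max Λ 1 with hΛ'
  have hΛ1 : 1 ≤ Λ' := le_max_right _ _
  -- The threshold is what the integral of `hpt` below yields: a factor `3Λ'` times the L² bound
  -- `Λ'`. Exceeding it for one `ε` rules out `|u_x| > ε^(-1/2)`.
  have h1 : ∀ᶠ ε in 𝓝[>] (0 : ℝ), ENNReal.ofReal (3 * Λ' * Λ') < ⨅ x, ∫⁻ y, ENNReal.ofReal
      (1 / (ε + ‖a x - a y‖ ^ 2 + ∫ u, (k x u - k y u) ^ 2 ∂μ)) ∂μ :=
    hOut.eventually (lt_mem_nhds ENNReal.ofReal_lt_top)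
  obtain ⟨ε, hε, hε0⟩ := (h1.and self_mem_nhdsWithin).exists
  have hε0 : 0 < ε := hε0
  refine ⟨√(ε⁻¹), fun z u hu hL => BB.norm_le (Real.sqrt_nonneg _) fun x => ?_⟩
  by_contra! hx
  have hx2 : (‖u x‖⁻¹) ^ 2 ≤ ε := by
    have : ε⁻¹ < ‖u x‖ ^ 2 := (Real.sqrt_lt' (hu.norm_pos x)).1 hx
    rw [inv_pow]
    exact inv_le_of_inv_le₀ hε0 this.le
  have hL' : ∫ x, ‖u x‖ ^ 2 ∂μ ≤ Λ' := hL.trans (le_max_left _ _)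
  have hr := u.bddMeas.norm
  -- Subtracting the equations at `x` and `y` removes `z`: `1/|u_y|` is at most `1/|u_x| + |a_x -
  -- a_y| + |(Su)_x - (Su)_y|`, and the last term is at most `‖S_x - S_y‖₂ √Λ'`. The 3 comes from
  -- squaring a sum of three terms.
  have hpt : ∀ y, 1 / (ε + ‖a x - a y‖ ^ 2 + ∫ u, (k x u - k y u) ^ 2 ∂μ) ≤
      3 * Λ' * ‖u y‖ ^ 2 := by
    intro y
    have hd0 : 0 ≤ ∫ u, (k x u - k y u) ^ 2 ∂μ := integral_nonneg fun _ => sq_nonneg _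
    have hS : ‖S u y - S u x‖ ^ 2 ≤ (∫ u, (k x u - k y u) ^ 2 ∂μ) * Λ' := by
      have e : S u y - S u x = ∫ w, ((k y w - k x w : ℝ) : ℂ) * u w ∂μ := by
        rw [hk.apply_eq, hk.apply_eq, ← integral_sub (hk.integrable_mul_complex u y)
          (hk.integrable_mul_complex u x)]
        refine integral_congr_ae (ae_of_all _ fun w => ?_)
        push_cast
        ring
      have e2 : ‖S u y - S u x‖ ≤ ∫ w, |k y w - k x w| * ‖u w‖ ∂μ := by
        rw [e]
        refine (norm_integral_le_integral_norm _).trans (le_of_eq ?_)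
        refine integral_congr_ae (ae_of_all _ fun w => ?_)
        simp only [norm_mul, Complex.norm_real, Real.norm_eq_abs]
      have hkk : MemLp (fun w => k y w - k x w) 2 μ := (hk.memLp y).sub (hk.memLp x)
      have ⟨_, C, hC⟩ := hr
      have e3 := sq_integral_le (μ := μ) (f := fun w => |k y w - k x w| * ‖u w‖)
        (q := fun w => ‖u w‖ ^ 2)
        (((hkk.integrable one_le_two).abs).mul_bdd (c := C) hr.1.aestronglyMeasurable
          (ae_of_all _ hC)) hkk.integrable_sq hr.pow_two.integrable (fun _ => sq_nonneg _)
        (fun _ => sq_nonneg _) (fun w => by rw [mul_pow, sq_abs])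
      calc _ ≤ (∫ w, |k y w - k x w| * ‖u w‖ ∂μ) ^ 2 := pow_le_pow_left₀ (norm_nonneg _) e2 2
        _ ≤ _ := e3
        _ ≤ _ := by
          have e4 : ∫ w, (k y w - k x w) ^ 2 ∂μ = ∫ w, (k x w - k y w) ^ 2 ∂μ := by
            congr 1
            ext w
            ring
          rw [e4]
          exact mul_le_mul_of_nonneg_left hL' hd0
    have hy : ‖u y‖⁻¹ ≤ ‖u x‖⁻¹ + ‖a x - a y‖ + ‖S u y - S u x‖ := by
      rw [hu.inv_norm_eq, hu.inv_norm_eq, ← norm_neg (a x - a y)]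
      have e : z + a y + S u y = (z + a x + S u x) + -(a x - a y) + (S u y - S u x) := by ring
      calc _ = ‖(z + a x + S u x) + -(a x - a y) + (S u y - S u x)‖ := by rw [← e]
        _ ≤ _ := norm_add₃_le
    have h0 := hu.norm_pos y
    have hy2 : (‖u y‖⁻¹) ^ 2 ≤
        3 * Λ' * (ε + ‖a x - a y‖ ^ 2 + ∫ u, (k x u - k y u) ^ 2 ∂μ) := by
      have e1 : (‖u y‖⁻¹) ^ 2 ≤ (‖u x‖⁻¹ + ‖a x - a y‖ + ‖S u y - S u x‖) ^ 2 :=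
        pow_le_pow_left₀ (inv_nonneg.2 h0.le) hy 2
      have e2 : (‖u x‖⁻¹ + ‖a x - a y‖ + ‖S u y - S u x‖) ^ 2 ≤
          3 * ((‖u x‖⁻¹) ^ 2 + ‖a x - a y‖ ^ 2 + ‖S u y - S u x‖ ^ 2) := by
        nlinarith [sq_nonneg (‖u x‖⁻¹ - ‖a x - a y‖), sq_nonneg (‖u x‖⁻¹ - ‖S u y - S u x‖),
          sq_nonneg (‖a x - a y‖ - ‖S u y - S u x‖)]
      have e3 : ε ≤ Λ' * ε := le_mul_of_one_le_left hε0.le hΛ1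
      have e4 : ‖a x - a y‖ ^ 2 ≤ Λ' * ‖a x - a y‖ ^ 2 :=
        le_mul_of_one_le_left (sq_nonneg _) hΛ1
      linarith
    rw [inv_pow, inv_le_iff_one_le_mul₀ (by positivity)] at hy2
    rw [div_le_iff₀ (by positivity)]
    linarith
  have hfin : ∫⁻ y, ENNReal.ofReal
      (1 / (ε + ‖a x - a y‖ ^ 2 + ∫ u, (k x u - k y u) ^ 2 ∂μ)) ∂μ ≤
      ENNReal.ofReal (3 * Λ' * Λ') := by
    calc _ ≤ ∫⁻ y, ENNReal.ofReal (3 * Λ' * ‖u y‖ ^ 2) ∂μ :=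
          lintegral_mono fun y => ENNReal.ofReal_le_ofReal (hpt y)
      _ = ENNReal.ofReal (∫ y, 3 * Λ' * ‖u y‖ ^ 2 ∂μ) :=
          (ofReal_integral_eq_lintegral_ofReal (hr.pow_two.integrable.const_mul _)
            (ae_of_all _ fun y => by positivity)).symm
      _ ≤ _ := by
          rw [integral_const_mul]
          gcongr
  exact absurd (hε.trans_le (iInf_le _ x)) (not_lt.2 hfin)

end SolutionBounds

/-! ### Uniform bounds from L¹ bounds; the strong diagonal case -/

section UniformBounds

variable {X : Type*} [MeasurableSpace X] {μ : Measure X}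
  {S : BB X →L[ℂ] BB X} {k : X → X → ℝ} {a : BB X}

theorem isNonneg_ofFun {f : X → ℝ} (hf : BddMeas f) (h0 : ∀ x, 0 ≤ f x) :
    IsNonneg (ofFun fun x => (f x : ℂ)) := fun x => by
  rw [ofFun_apply hf.ofReal]
  exact ⟨Complex.ofReal_im _, h0 x⟩

theorem avg_ofFun {f : X → ℝ} (hf : BddMeas f) :
    avg μ (ofFun fun x => (f x : ℂ)) = ((∫ x, f x ∂μ : ℝ) : ℂ) := by
  simp only [avg, ofFun_apply hf.ofReal]
  exact integral_ofReal

variable [IsProbabilityMeasure μ]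

theorem re_avg (w : BB X) : (avg μ w).re = ∫ x, (w x).re ∂μ :=
  (integral_re w.bddMeas.integrable).symm

theorem IsNonneg.eq_ofFun {w : BB X} (h : IsNonneg w) : w = ofFun fun x => ((w x).re : ℂ) :=
  BB.ext fun x => by
    rw [ofFun_apply w.bddMeas.re.ofReal]
    exact Complex.ext rfl (h x).1

theorem pairing_ofFun (hk : IsSmoothingWithKernel μ S k) {f : X → ℝ} (hf : BddMeas f) :
    pairing μ (ofFun fun x => (f x : ℂ)) (S (ofFun fun x => (f x : ℂ))) =
      ((∫ x, f x * kop μ k f x ∂μ : ℝ) : ℂ) := by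
  simp only [pairing, hk.apply_ofReal hf, ofFun_apply hf.ofReal, Complex.conj_ofReal,
    ← Complex.ofReal_mul]
  exact integral_complex_ofReal

theorem re_pairing_nonneg (hk : IsSmoothingWithKernel μ S k) {w : BB X} (hw : IsNonneg w) :
    0 ≤ (pairing μ w (S w)).re := by
  rw [hw.eq_ofFun, pairing_ofFun hk w.bddMeas.re, Complex.ofReal_re]
  exact integral_nonneg fun x => mul_nonneg (hw x).2 (kop_nonneg hk (fun y => (hw y).2) x)

/-- Write `S^L 1 = S w` with `w = S^(L-1) 1` bounded; then `ρ ≤ S w ≤ (‖w‖ + 1) S1`. -/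
theorem IsUniformlyPrimitive.exists_le_kop_one (hA3 : IsUniformlyPrimitive μ S)
    (hk : IsSmoothingWithKernel μ S k) : ∃ κ : ℝ, 0 < κ ∧ ∀ x, κ ≤ kop μ k (fun _ => 1) x := by
  obtain ⟨L, hL, ρ, hρ, h⟩ := hA3
  set e : BB X := ofFun fun _ => ((1 : ℝ) : ℂ) with he
  set w := (S ^ (L - 1)) e with hw
  have h1 : (S ^ L) e = S w := by
    obtain ⟨n, rfl⟩ := Nat.exists_eq_add_of_le' hL
    rw [pow_succ']
    rfl
  have havg : (avg μ e).re = 1 := by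
    rw [he, avg_ofFun (BddMeas.const 1)]
    simp
  refine ⟨ρ / (‖w‖ + 1), by positivity, fun x => ?_⟩
  have h2 := h e (isNonneg_ofFun (BddMeas.const 1) fun _ => zero_le_one) x
  rw [h1, havg, mul_one, hk.re_apply] at h2
  rw [div_le_iff₀ (by positivity), mul_comm, ← kop_const_mul]
  refine h2.trans (hk.kop_mono w.bddMeas.re (BddMeas.const _) (fun y => ?_) x)
  have := (Complex.re_le_norm _).trans (BB.norm_apply_le w y)
  linarith

/-- Solutions are uniformly bounded away from a disc around the origin. -/
theorem exists_bound_of_le_norm (hk : IsSmoothingWithKernel μ S k)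
    (hA1 : IsSymmetricPositive μ S) (ha : IsRealValued a) (hOut : NoOutliers μ k a) {δ : ℝ}
    (hδ : 0 < δ) : ∃ C : ℝ, ∀ (z : ℂ) (u : BB X), 0 < z.im → IsSolutionAt S a z u →
      ‖a‖ + δ ≤ ‖z‖ → ‖u‖ ≤ C := by
  obtain ⟨C, hC⟩ := hOut.exists_bound hk (4 / δ ^ 2)
  refine ⟨C, fun z u hz hu hzδ => hC z u hu ?_⟩
  have h1 := hu.sq_mul_integral_sq_le hk hA1 ha hz (by linarith)
  rw [le_div_iff₀ (by positivity), mul_comm]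
  refine le_trans ?_ h1
  refine mul_le_mul_of_nonneg_right ?_ (integral_nonneg fun _ => sq_nonneg _)
  exact pow_le_pow_left₀ hδ.le (by linarith) 2

/-- For bounded spectral parameters an `L¹`-bound on solutions implies a uniform bound. -/
theorem exists_bound_of_integral_le (hk : IsSmoothingWithKernel μ S k)
    (hA1 : IsSymmetricPositive μ S) (ha : IsRealValued a) (hOut : NoOutliers μ k a)
    (hA3 : IsUniformlyPrimitive μ S) (R C₁ : ℝ) : ∃ C : ℝ, ∀ (z : ℂ) (u : BB X), 0 < z.im →
      IsSolutionAt S a z u → ‖z‖ ≤ R → ∫ x, ‖u x‖ ∂μ ≤ C₁ → ‖u‖ ≤ C := by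
  obtain ⟨κ, hκ, hκ'⟩ := hA3.exists_le_kop_one hk
  obtain ⟨D, hD1, hD⟩ := hk.exists_sq_bound
  obtain ⟨C, hC⟩ := hOut.exists_bound hk ((((R + ‖a‖) * D + D * C₁) / κ ^ 2) ^ 2)
  exact ⟨C, fun z u hz hu hzR h1 => hC z u hu
    (hu.integral_sq_le hk hA1 ha hz hD1 hD hκ hκ' hzR h1)⟩

theorem IsSolutionAt.integral_norm_pos {z : ℂ} {u : BB X} (hu : IsSolutionAt S a z u)
    (hk : IsSmoothingWithKernel μ S k) (ha : IsRealValued a) (hz : 0 < z.im) :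
    0 < ∫ x, ‖u x‖ ∂μ := by
  obtain ⟨c, hc, hcu⟩ := hu.exists_le_im hk ha hz
  calc 0 < c := hc
    _ = ∫ _, c ∂μ := by simp
    _ ≤ _ := integral_mono (integrable_const _) u.bddMeas.norm.integrable
      fun x => (hcu x).trans (Complex.im_le_norm _)

/-- Testing the strong diagonal condition on `|u|` gives `c⟨|u|⟩² ≤ ⟨|u|, S|u|⟩`, and the right side
is at most one for every solution. -/
theorem HasStrongDiagonal.exists_integral_le (hd : HasStrongDiagonal μ S)
    (hk : IsSmoothingWithKernel μ S k) (hA1 : IsSymmetricPositive μ S) (ha : IsRealValued a) :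
    ∃ C : ℝ, ∀ (z : ℂ) (u : BB X), 0 < z.im → IsSolutionAt S a z u → ∫ x, ‖u x‖ ∂μ ≤ C := by
  obtain ⟨c, hc⟩ : ∃ c, c = sInf {r : ℝ | ∃ w : BB X, IsNonneg w ∧ avg μ w ≠ 0 ∧
    r = (pairing μ w (S w)).re / (avg μ w).re ^ 2} := ⟨_, rfl⟩
  have hc0 : 0 < c := hc ▸ hd
  refine ⟨1 + c⁻¹, fun z u hz hu => ?_⟩
  have hr := u.bddMeas.norm
  have hpos := hu.integral_norm_pos hk ha hz
  have hn := isNonneg_ofFun hr fun x => norm_nonneg _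
  have h1 : c ≤ (∫ x, ‖u x‖ * kop μ k (fun y => ‖u y‖) x ∂μ) / (∫ x, ‖u x‖ ∂μ) ^ 2 := by
    rw [hc]
    refine csInf_le ⟨0, ?_⟩ ⟨ofFun fun x => (‖u x‖ : ℂ), hn, ?_, ?_⟩
    · rintro r ⟨w, hw, -, rfl⟩
      exact div_nonneg (re_pairing_nonneg hk hw) (sq_nonneg _)
    · rw [avg_ofFun hr]
      exact_mod_cast hpos.ne'
    · rw [avg_ofFun hr, Complex.ofReal_re]
      rw [pairing_ofFun hk hr, Complex.ofReal_re]
  rw [le_div_iff₀ (by positivity)] at h1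
  have h2 := h1.trans (hu.integral_mul_kop_le hk hA1 ha hz)
  have h3 : (∫ x, ‖u x‖ ∂μ) ^ 2 ≤ c⁻¹ := by
    rw [← one_div, le_div_iff₀ hc0, mul_comm]
    exact h2
  nlinarith [sq_nonneg ((∫ x, ‖u x‖ ∂μ) - 1)]

theorem exists_bound_of_hasStrongDiagonal (hk : IsSmoothingWithKernel μ S k)
    (hA1 : IsSymmetricPositive μ S) (ha : IsRealValued a) (hOut : NoOutliers μ k a)
    (hA3 : IsUniformlyPrimitive μ S) (hd : HasStrongDiagonal μ S) :
    ∃ C : ℝ, ∀ (z : ℂ) (u : BB X), 0 < z.im → IsSolutionAt S a z u → ‖u‖ ≤ C := by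
  obtain ⟨C₁, h₁⟩ := exists_bound_of_le_norm hk hA1 ha hOut one_pos
  obtain ⟨D, hD⟩ := hd.exists_integral_le hk hA1 ha
  obtain ⟨C₂, h₂⟩ := exists_bound_of_integral_le hk hA1 ha hOut hA3 (‖a‖ + 1) D
  refine ⟨max C₁ C₂, fun z u hz hu => ?_⟩
  rcases le_total (‖a‖ + 1) ‖z‖ with h | h
  · exact (h₁ z u hz hu h).trans (le_max_left _ _)
  · exact (h₂ z u hz hu h (hD z u hz hu)).trans (le_max_right _ _)

end UniformBounds

/-! ### Fully indecomposable matrices and primitivity of the operator -/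

section Block

theorem clm_pow_one_apply {E : Type*} [NormedAddCommGroup E] [NormedSpace ℂ E] (S : E →L[ℂ] E)
    (u : E) : (S ^ 1) u = S u := by
  rw [pow_one]

theorem clm_pow_succ_apply {E : Type*} [NormedAddCommGroup E] [NormedSpace ℂ E] (S : E →L[ℂ] E)
    (n : ℕ) (u : E) : (S ^ (n + 1)) u = (S ^ n) (S u) := by
  rw [pow_succ]
  rfl

theorem clm_pow_succ_apply' {E : Type*} [NormedAddCommGroup E] [NormedSpace ℂ E] (S : E →L[ℂ] E)
    (n : ℕ) (u : E) : (S ^ (n + 1)) u = S ((S ^ n) u) := by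
  rw [pow_succ']
  rfl

/-- The column indices of the non-zero entries in the rows `I` of `T`. -/
noncomputable def colNeighbors {K : ℕ} (T : Matrix (Fin K) (Fin K) ℝ) (I : Finset (Fin K)) :
    Finset (Fin K) :=
  {j | ∃ i ∈ I, T i j ≠ 0}

theorem mem_colNeighbors {K : ℕ} {T : Matrix (Fin K) (Fin K) ℝ} {I : Finset (Fin K)} {j : Fin K} :
    j ∈ colNeighbors T I ↔ ∃ i ∈ I, T i j ≠ 0 := by
  simp [colNeighbors]

namespace IsFullyIndecomposable

variable {K : ℕ} {T : Matrix (Fin K) (Fin K) ℝ}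

/-- The rows `I` and the columns outside its neighbourhood form a zero submatrix; it would be too
large if the neighbourhood had at most `|I|` elements and were not everything. -/
theorem le_card_colNeighbors (hT : IsFullyIndecomposable T) {I : Finset (Fin K)}
    (hI : I.Nonempty) : min K (I.card + 1) ≤ (colNeighbors T I).card := by
  by_contra! h
  have hc : (colNeighbors T I)ᶜ.card = K - (colNeighbors T I).card := by
    rw [Finset.card_compl, Fintype.card_fin]
  have h1 : (colNeighbors T I).card < K := h.trans_le (min_le_left _ _)
  have h2 : (colNeighbors T I).card < I.card + 1 := h.trans_le (min_le_right _ _)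
  obtain ⟨i, hi, j, hj, hij⟩ := hT.2 I (colNeighbors T I)ᶜ hI
    (Finset.card_pos.1 (by omega)) (by omega)
  exact Finset.mem_compl.1 hj (mem_colNeighbors.2 ⟨i, hi, hij⟩)

theorem exists_ne_zero (hT : IsFullyIndecomposable T) (i : Fin K) : ∃ j, T i j ≠ 0 := by
  have h := hT.le_card_colNeighbors (Finset.singleton_nonempty i)
  have hK := i.pos
  obtain ⟨j, hj⟩ : (colNeighbors T {i}).Nonempty := Finset.card_pos.1 (by
    rw [Finset.card_singleton] at h
    omega)
  obtain ⟨i', hi', h'⟩ := mem_colNeighbors.1 hj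
  rw [Finset.mem_singleton.1 hi'] at h'
  exact ⟨j, h'⟩

/-- Every position of a fully indecomposable matrix lies on a diagonal whose other entries are
non-zero. -/
theorem exists_perm (hT : IsFullyIndecomposable T) (i j : Fin K) :
    ∃ σ : Equiv.Perm (Fin K), σ i = j ∧ ∀ l ≠ i, T l (σ l) ≠ 0 := by
  classical
  -- Hall's theorem: row `i` is forced to column `j`, which is removed from the other rows. The
  -- surplus of one column in `le_card_colNeighbors` pays for the removal.
  let t : Fin K → Finset (Fin K) := fun l =>
    if l = i then {j} else (colNeighbors T {l}).erase j
  have hall : ∀ s : Finset (Fin K), s.card ≤ (s.biUnion t).card := by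
    intro s
    have hs1 : ∀ s' : Finset (Fin K), i ∉ s' → s'.Nonempty →
        (colNeighbors T s').erase j ⊆ s'.biUnion t := by
      intro s' hi _ l hl
      obtain ⟨hlj, hl⟩ := Finset.mem_erase.1 hl
      obtain ⟨i', hi', h'⟩ := mem_colNeighbors.1 hl
      refine Finset.mem_biUnion.2 ⟨i', hi', ?_⟩
      have : i' ≠ i := fun h => hi (h ▸ hi')
      simp only [t, if_neg this]
      exact Finset.mem_erase.2 ⟨hlj, mem_colNeighbors.2 ⟨i', Finset.mem_singleton_self _, h'⟩⟩
    have hs2 : ∀ s' : Finset (Fin K), i ∉ s' → s'.card ≤ ((colNeighbors T s').erase j).card := by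
      intro s' hi
      rcases s'.eq_empty_or_nonempty with rfl | hne
      · simp
      have h1 := hT.le_card_colNeighbors hne
      have h2 := Finset.pred_card_le_card_erase (s := colNeighbors T s') (a := j)
      have h3 : s'.card < K := by
        have := Finset.card_lt_univ_of_notMem hi
        rwa [Fintype.card_fin] at this
      omega
    by_cases hi : i ∈ s
    · rcases (s.erase i).eq_empty_or_nonempty with he | hne
      · have : s = {i} := by
          rw [← Finset.insert_erase hi, he, insert_empty_eq]
        subst this
        simp [t]
      · have hsub : insert j ((colNeighbors T (s.erase i)).erase j) ⊆ s.biUnion t := by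
          refine Finset.insert_subset (Finset.mem_biUnion.2 ⟨i, hi, by simp [t]⟩) ?_
          exact (hs1 _ (Finset.notMem_erase i s) hne).trans
            (Finset.biUnion_subset_biUnion_of_subset_left _ (Finset.erase_subset i s))
        have h1 := Finset.card_le_card hsub
        rw [Finset.card_insert_of_notMem (Finset.notMem_erase j _)] at h1
        have h2 := hs2 _ (Finset.notMem_erase i s)
        have h3 := Finset.card_erase_add_one hi
        omega
    · rcases s.eq_empty_or_nonempty with rfl | hne
      · simp
      exact (hs2 s hi).trans (Finset.card_le_card (hs1 s hi hne))
  obtain ⟨f, hf, hft⟩ := (Finset.all_card_le_biUnion_card_iff_exists_injective t).1 hall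
  refine ⟨Equiv.ofBijective f (Finite.injective_iff_bijective.1 hf), ?_, fun l hl => ?_⟩
  · have := hft i
    simpa [t] using this
  · have := hft l
    simp only [t, if_neg hl] at this
    obtain ⟨i', hi', h'⟩ := mem_colNeighbors.1 (Finset.mem_of_mem_erase this)
    rw [Finset.mem_singleton.1 hi'] at h'
    exact h'

theorem exists_le_entry (hT : IsFullyIndecomposable T) :
    ∃ t : ℝ, 0 < t ∧ ∀ i j, T i j ≠ 0 → t ≤ T i j := by
  classical
  rcases isEmpty_or_nonempty (Fin K × Fin K) with h | h
  · exact ⟨1, one_pos, fun i j => (h.false (i, j)).elim⟩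
  -- Zero entries are replaced by the harmless value 1, so that the minimum is positive.
  obtain ⟨p, hp⟩ := Finite.exists_min fun p : Fin K × Fin K =>
    if T p.1 p.2 = 0 then (1 : ℝ) else T p.1 p.2
  refine ⟨if T p.1 p.2 = 0 then (1 : ℝ) else T p.1 p.2, ?_, fun i j hij => ?_⟩
  · split_ifs with h0
    · exact one_pos
    · exact lt_of_le_of_ne (hT.1 _ _) (Ne.symm h0)
  · simpa [hij] using hp (i, j)

end IsFullyIndecomposable

variable {X : Type*} [MeasurableSpace X]

/-- The kernel `k` is bounded below by the matrix `T` on the blocks of the partition `B`. -/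
structure IsBlockBound (μ : Measure X) (k : X → X → ℝ) {K : ℕ} (T : Matrix (Fin K) (Fin K) ℝ)
    (B : Fin K → Set X) : Prop where
  pos : 1 ≤ K
  indecomposable : IsFullyIndecomposable T
  measurableSet : ∀ i, MeasurableSet (B i)
  disjoint : Pairwise fun i j => Disjoint (B i) (B j)
  iUnion_eq : (⋃ i, B i) = univ
  measure_eq : ∀ i, μ (B i) = (K : ℝ≥0∞)⁻¹
  le_kernel : ∀ i j, ∀ x ∈ B i, ∀ y ∈ B j, T i j ≤ k x y

variable {μ : Measure X} {k : X → X → ℝ} {K : ℕ} {T : Matrix (Fin K) (Fin K) ℝ} {B : Fin K → Set X}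

theorem IsBlockFullyIndecomposable.exists_isBlockBound (h : IsBlockFullyIndecomposable μ k) :
    ∃ (K : ℕ) (T : Matrix (Fin K) (Fin K) ℝ) (B : Fin K → Set X), IsBlockBound μ k T B := by
  obtain ⟨K, hK, T, hT, B, h1, h2, h3, h4, h5⟩ := h
  exact ⟨K, T, B, hK, hT, h1, h2, h3, h4, h5⟩

namespace IsBlockBound

theorem measureReal_eq (h : IsBlockBound μ k T B) (i : Fin K) : μ.real (B i) = (K : ℝ)⁻¹ := by
  rw [Measure.real, h.measure_eq, ENNReal.toReal_inv, ENNReal.toReal_natCast]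

theorem exists_mem (h : IsBlockBound μ k T B) (x : X) : ∃ i, x ∈ B i :=
  mem_iUnion.1 (h.iUnion_eq ▸ mem_univ x)

theorem sum_setIntegral (h : IsBlockBound μ k T B) {f : X → ℝ} (hf : Integrable f μ) :
    ∑ i, ∫ x in B i, f x ∂μ = ∫ x, f x ∂μ := by
  rw [← integral_iUnion_fintype h.measurableSet h.disjoint fun i => hf.integrableOn, h.iUnion_eq,
    setIntegral_univ]

variable [IsProbabilityMeasure μ] {S : BB X →L[ℂ] BB X}

theorem mul_setIntegral_le_kop (h : IsBlockBound μ k T B) (hk : IsSmoothingWithKernel μ S k)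
    {f : X → ℝ} (hf : BddMeas f) (hf0 : ∀ x, 0 ≤ f x) {i j : Fin K} {x : X} (hx : x ∈ B i) :
    T i j * ∫ y in B j, f y ∂μ ≤ kop μ k f x := by
  rw [← integral_const_mul]
  calc _ ≤ ∫ y in B j, k x y * f y ∂μ :=
        setIntegral_mono_on (hf.integrable.const_mul _).integrableOn
          (hk.integrable_mul hf x).integrableOn (h.measurableSet j)
          fun y hy => mul_le_mul_of_nonneg_right (h.le_kernel i j x hx y hy) (hf0 y)
    _ ≤ _ := setIntegral_le_integral (hk.integrable_mul hf x)
        (ae_of_all _ fun y => mul_nonneg (hk.nonneg x y) (hf0 y))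

/-- `N i` collects blocks that `n + 1` applications of `S` connect to block `i`. Each step replaces
it by its column neighbourhood, which gains at least one block until all are reached. -/
theorem exists_reach (h : IsBlockBound μ k T B) (hk : IsSmoothingWithKernel μ S k)
    (hA1 : IsSymmetricPositive μ S) (n : ℕ) : ∃ c : ℝ, 0 < c ∧ ∃ N : Fin K → Finset (Fin K),
      (∀ i, min K (n + 1) ≤ (N i).card) ∧ ∀ u : BB X, IsNonneg u → ∀ i, ∀ x ∈ B i, ∀ j ∈ N i,
        c * ∫ y in B j, (u y).re ∂μ ≤ ((S ^ (n + 1)) u x).re := by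
  obtain ⟨t, ht, htT⟩ := h.indecomposable.exists_le_entry
  have hK : (0 : ℝ) < K := by exact_mod_cast h.pos
  have hint : ∀ u : BB X, IsNonneg u → ∀ j, 0 ≤ ∫ y in B j, (u y).re ∂μ := fun u hu j =>
    integral_nonneg fun y => (hu y).2
  have step : ∀ u : BB X, IsNonneg u → ∀ i j, T i j ≠ 0 → ∀ x ∈ B i,
      t * ∫ y in B j, (u y).re ∂μ ≤ (S u x).re := by
    intro u hu i j hij x hx
    rw [hk.re_apply]
    exact (mul_le_mul_of_nonneg_right (htT i j hij) (hint u hu j)).trans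
      (h.mul_setIntegral_le_kop hk u.bddMeas.re (fun y => (hu y).2) hx)
  induction n with
  | zero =>
    refine ⟨t, ht, fun i => colNeighbors T {i}, fun i => ?_, fun u hu i x hx j hj => ?_⟩
    · have := h.indecomposable.le_card_colNeighbors (Finset.singleton_nonempty i)
      rw [Finset.card_singleton] at this
      exact le_trans (by omega) this
    · obtain ⟨i', hi', hT'⟩ := mem_colNeighbors.1 hj
      rw [Finset.mem_singleton.1 hi'] at hT'
      exact (step u hu i j hT' x hx).trans_eq (by rw [zero_add, clm_pow_one_apply])
  | succ n ih =>
    obtain ⟨c, hc, N, hN, hcN⟩ := ih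
    refine ⟨c * (t * (K : ℝ)⁻¹), by positivity, fun i => colNeighbors T (N i), fun i => ?_,
      fun u hu i x hx l hl => ?_⟩
    · have hKp := h.pos
      have h1 := hN i
      have h2 := h.indecomposable.le_card_colNeighbors (I := N i) (Finset.card_pos.1 (by omega))
      refine le_trans ?_ h2
      omega
    · obtain ⟨j, hj, hjl⟩ := mem_colNeighbors.1 hl
      have h1 := hcN (S u) (hA1.2 u hu) i x hx j hj
      rw [clm_pow_succ_apply]
      refine le_trans ?_ h1
      rw [mul_assoc]
      refine mul_le_mul_of_nonneg_left ?_ hc.le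
      have h2 := setIntegral_ge_of_const_le_real (μ := μ) (h.measurableSet j) (measure_ne_top μ _)
        (step u hu j l hjl) (S u).bddMeas.re.integrable.integrableOn
      rw [h.measureReal_eq] at h2
      linarith

theorem exists_odd_pow_lower_bound (h : IsBlockBound μ k T B) (hk : IsSmoothingWithKernel μ S k)
    (hA1 : IsSymmetricPositive μ S) : ∃ n : ℕ, Odd n ∧ ∃ ρ : ℝ, 0 < ρ ∧
      ∀ u : BB X, IsNonneg u → ∀ x, ρ * (avg μ u).re ≤ ((S ^ n) u x).re := by
  obtain ⟨c, hc, N, hN, hcN⟩ := h.exists_reach hk hA1 (2 * K)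
  have hK : (0 : ℝ) < K := by exact_mod_cast h.pos
  -- Any exponent at least `K` reaches all blocks; this one is odd, as is needed later to invert `1
  -- + vSv`. Averaging over the `K` target blocks gives `c / K`.
  refine ⟨2 * K + 1, ⟨K, rfl⟩, c / K, by positivity, fun u hu x => ?_⟩
  obtain ⟨i, hi⟩ := h.exists_mem x
  have hNi : N i = Finset.univ := by
    rw [← Finset.card_eq_iff_eq_univ, Fintype.card_fin]
    have h1 := hN i
    have h2 := (N i).card_le_univ
    rw [Fintype.card_fin] at h2
    omega
  have h1 : ∑ j, c * ∫ y in B j, (u y).re ∂μ ≤ ∑ _j : Fin K, ((S ^ (2 * K + 1)) u x).re :=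
    Finset.sum_le_sum fun j _ => hcN u hu i x hi j (hNi ▸ Finset.mem_univ j)
  rw [← Finset.mul_sum, h.sum_setIntegral u.bddMeas.re.integrable, Finset.sum_const,
    Finset.card_univ, Fintype.card_fin, nsmul_eq_mul] at h1
  rw [re_avg, div_mul_eq_mul_div, div_le_iff₀ hK, mul_comm _ (K : ℝ)]
  exact h1

theorem isUniformlyPrimitive (h : IsBlockBound μ k T B) (hk : IsSmoothingWithKernel μ S k)
    (hA1 : IsSymmetricPositive μ S) : IsUniformlyPrimitive μ S := by
  obtain ⟨n, hn, ρ, hρ, hS⟩ := h.exists_odd_pow_lower_bound hk hA1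
  exact ⟨n, hn.pos, ρ, hρ, hS⟩

end IsBlockBound

end Block

/-! ### Case (i) on the imaginary axis -/

section ImaginaryAxis

variable {X : Type*} [MeasurableSpace X] {μ : Measure X} [IsProbabilityMeasure μ]
  {S : BB X →L[ℂ] BB X} {k : X → X → ℝ} {K : ℕ} {T : Matrix (Fin K) (Fin K) ℝ} {B : Fin K → Set X}

/-- The product `∏ N` cannot be large along diagonals of `T`, yet it is at least `p`, so no single
`N i` is small; a non-zero entry `T i j` then bounds `N i ≤ Q / N j` from above. -/
theorem IsFullyIndecomposable.le_of_mul_le (hT : IsFullyIndecomposable T) {N : Fin K → ℝ}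
    (hN : ∀ i, 0 < N i) {p Q : ℝ} (hp : 0 < p) (hQ : 0 < Q)
    (h1 : ∀ i j, T i j ≠ 0 → N i * N j ≤ Q) (h2 : p ≤ ∏ i, N i) (i : Fin K) :
    N i ≤ Q / √(p ^ 2 / Q ^ (K - 1)) := by
  have lower : ∀ i, √(p ^ 2 / Q ^ (K - 1)) ≤ N i := by
    intro i
    refine Real.sqrt_le_iff.2 ⟨(hN i).le, ?_⟩
    -- Along the diagonal through `(i, i)` the square of the product is `N i ^ 2` times `K - 1`
    -- factors, each at most `Q`. The entry `T i i` itself may vanish.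
    obtain ⟨σ, hσ, hσ'⟩ := hT.exists_perm i i
    have e : (∏ l, N l) ^ 2 = ∏ l, N l * N (σ l) := by
      rw [Finset.prod_mul_distrib, Equiv.prod_comp σ N, sq]
    rw [← Finset.mul_prod_erase _ (fun l => N l * N (σ l)) (Finset.mem_univ i), hσ] at e
    have h3 : ∏ l ∈ Finset.univ.erase i, N l * N (σ l) ≤ Q ^ (K - 1) := by
      calc _ ≤ ∏ _l ∈ Finset.univ.erase i, Q :=
            Finset.prod_le_prod (fun l _ => (mul_pos (hN l) (hN _)).le)
              fun l hl => h1 _ _ (hσ' l (Finset.ne_of_mem_erase hl))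
        _ = Q ^ (K - 1) := by
          rw [Finset.prod_const, Finset.card_erase_of_mem (Finset.mem_univ i), Finset.card_univ,
            Fintype.card_fin]
    rw [div_le_iff₀ (by positivity)]
    calc p ^ 2 ≤ (∏ l, N l) ^ 2 := pow_le_pow_left₀ hp.le h2 2
      _ ≤ _ := by
        rw [e, sq]
        exact mul_le_mul_of_nonneg_left h3 (mul_pos (hN i) (hN i)).le
  obtain ⟨j, hj⟩ := hT.exists_ne_zero i
  have h0 : 0 < √(p ^ 2 / Q ^ (K - 1)) := by positivity
  rw [le_div_iff₀ h0]
  exact (mul_le_mul_of_nonneg_left (lower j) (hN i).le).trans (h1 i j hj)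

/-- The variational lower bound on the logarithm of the solution on the imaginary axis. -/
theorem le_integral_log (hk : IsSmoothingWithKernel μ S k) (hA1 : IsSymmetricPositive μ S)
    {C : ℝ} (hC1 : 1 ≤ C) (hC : ∀ x, ∫ y, k x y ^ 2 ∂μ ≤ C) {η c : ℝ} (hη : 0 < η) (hc : 0 < c)
    {v : X → ℝ} (hv : BddMeas v) (hcv : ∀ x, c ≤ v x) (h : ∀ x, v x * (η + kop μ k v x) = 1) :
    -(C + 2 * η) ≤ 2 * ∫ x, Real.log (v x) ∂μ := by
  have hv0 : ∀ x, 0 < v x := fun x => hc.trans_le (hcv x)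
  have hlog : BddMeas fun x => Real.log (v x) := by
    obtain ⟨mv, D, hD⟩ := hv
    refine ⟨Real.measurable_log.comp mv, max |Real.log c| |Real.log D|, fun x => ?_⟩
    have h1 : v x ≤ D := (le_abs_self _).trans (hD x)
    exact abs_le_max_abs_abs (Real.log_le_log hc (hcv x)) (Real.log_le_log (hv0 x) h1)
  have hvl := hv.mul hlog
  have hTv := hk.bddMeas_kop hv
  have hTvl := hk.bddMeas_kop hvl
  -- Entropy inequality with maximum at `s = 1`. It is applied to `s = v_x v_y`, weighted by the
  -- kernel, and to `s = v_x`, weighted by `2η`.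
  have ent : ∀ s : ℝ, 0 < s → s * (1 - Real.log s) ≤ 1 := by
    intro s hs
    have h1 := Real.one_sub_inv_le_log_of_pos hs
    have h2 := mul_le_mul_of_nonneg_left h1 hs.le
    rw [mul_sub, mul_one, mul_inv_cancel₀ hs.ne'] at h2
    linarith
  have h1 : ∀ x, v x * kop μ k v x - v x * kop μ k v x * Real.log (v x) -
      v x * kop μ k (fun y => v y * Real.log (v y)) x ≤ kop μ k (fun _ => 1) x := by
    intro x
    have e : kop μ k (fun y => v x * (1 - Real.log (v x)) * v y +
        -v x * (v y * Real.log (v y))) x = v x * kop μ k v x - v x * kop μ k v x * Real.log (v x) -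
        v x * kop μ k (fun y => v y * Real.log (v y)) x := by
      rw [hk.kop_add ((BddMeas.const _).mul hv) ((BddMeas.const _).mul hvl), kop_const_mul,
        kop_const_mul]
      ring
    rw [← e]
    refine hk.kop_mono (((BddMeas.const _).mul hv).add ((BddMeas.const _).mul hvl))
      (BddMeas.const _) (fun y => ?_) x
    have := ent (v x * v y) (mul_pos (hv0 x) (hv0 y))
    rw [Real.log_mul (hv0 x).ne' (hv0 y).ne'] at this
    linarith
  -- The equation `v(η + Sv) = 1` trades `2 log v` for `2(ηv + v Sv) log v`. The bracket is
  -- antisymmetric and integrates to zero by symmetry of `S`.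
  have h2 : ∀ x, v x * kop μ k v x - 2 * Real.log (v x) +
      (kop μ k v x * (v x * Real.log (v x)) -
      v x * kop μ k (fun y => v y * Real.log (v y)) x) ≤ kop μ k (fun _ => 1) x + 2 * η := by
    intro x
    have e1 := mul_le_mul_of_nonneg_left (ent (v x) (hv0 x)) (by positivity : 0 ≤ 2 * η)
    have e2 := h x
    have e3 : 0 < η * v x := mul_pos hη (hv0 x)
    have e4 : 2 * Real.log (v x) = 2 * (v x * (η + kop μ k v x)) * Real.log (v x) := by
      rw [e2]
      ring
    have e5 := h1 x
    nlinarith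
  have i1 : Integrable (fun x => v x * kop μ k v x) μ := (hv.mul hTv).integrable
  have i2 : Integrable (fun x => kop μ k v x * (v x * Real.log (v x))) μ :=
    (hTv.mul hvl).integrable
  have i3 : Integrable (fun x => v x * kop μ k (fun y => v y * Real.log (v y)) x) μ :=
    (hv.mul hTvl).integrable
  have i4 : Integrable (fun x => 2 * Real.log (v x)) μ := hlog.integrable.const_mul 2
  have h3 : ∫ x, (v x * kop μ k v x - 2 * Real.log (v x) +
      (kop μ k v x * (v x * Real.log (v x)) -
      v x * kop μ k (fun y => v y * Real.log (v y)) x)) ∂μ ≤ C + 2 * η := by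
    calc _ ≤ ∫ _, (C + 2 * η) ∂μ :=
          integral_mono ((i1.sub i4).add (i2.sub i3)) (integrable_const _)
            fun x => (h2 x).trans (add_le_add_left (hk.kop_one_le hC1 hC x) _)
      _ = _ := by simp
  have e3 : ∫ x, (v x * kop μ k v x - 2 * Real.log (v x) +
      (kop μ k v x * (v x * Real.log (v x)) -
      v x * kop μ k (fun y => v y * Real.log (v y)) x)) ∂μ =
      ∫ x, v x * kop μ k v x ∂μ - 2 * ∫ x, Real.log (v x) ∂μ := by
    refine (integral_add (i1.sub i4) (i2.sub i3)).trans ?_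
    rw [integral_sub' i1 i4, integral_sub' i2 i3, hk.integral_mul_kop hA1 hv hvl, sub_self, add_zero,
      integral_const_mul]
  have h4 : 0 ≤ ∫ x, v x * kop μ k v x ∂μ :=
    integral_nonneg fun x => mul_nonneg (hv0 x).le (kop_nonneg hk (fun y => (hv0 y).le) x)
  linarith

/-- With `N i` the average of `v` over block `i`, the equation bounds `N i * N j` when `T i j ≠ 0`,
and the bound on `∫ log v` with Jensen bounds `∏ N i` from below, uniformly for `η ≤ 1`. -/
theorem IsBlockBound.exists_integral_le (hB : IsBlockBound μ k T B)
    (hk : IsSmoothingWithKernel μ S k) (hA1 : IsSymmetricPositive μ S) :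
    ∃ C₁ : ℝ, ∀ η : ℝ, 0 < η → η ≤ 1 → ∀ c : ℝ, 0 < c → ∀ v : X → ℝ, BddMeas v → (∀ x, c ≤ v x) →
      (∀ x, v x * (η + kop μ k v x) = 1) → ∫ x, v x ∂μ ≤ C₁ := by
  obtain ⟨C, hC1, hC⟩ := hk.exists_sq_bound
  obtain ⟨t, ht, htT⟩ := hB.indecomposable.exists_le_entry
  have hK : (0 : ℝ) < K := by exact_mod_cast hB.pos
  set Q : ℝ := K ^ 2 / t with hQ
  set p : ℝ := Real.exp (-(K * ((C + 2) / 2))) with hp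
  refine ⟨Q / √(p ^ 2 / Q ^ (K - 1)), fun η hη hη1 c hc v hv hcv h => ?_⟩
  have hv0 : ∀ x, 0 < v x := fun x => hc.trans_le (hcv x)
  set N : Fin K → ℝ := fun i => K * ∫ x in B i, v x ∂μ with hNdef
  have hM : ∀ i, 0 < ∫ x in B i, v x ∂μ := by
    intro i
    refine lt_of_lt_of_le ?_ (setIntegral_ge_of_const_le_real (hB.measurableSet i)
      (measure_ne_top μ _) (fun x _ => hcv x) hv.integrable.integrableOn)
    rw [hB.measureReal_eq]
    positivity
  have hN : ∀ i, 0 < N i := fun i => mul_pos hK (hM i)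
  have hTv := hk.bddMeas_kop hv
  have h1 : ∀ i j, T i j ≠ 0 → N i * N j ≤ Q := by
    intro i j hij
    have e1 : ∀ x ∈ B i, v x * (t * ∫ y in B j, v y ∂μ) ≤ 1 := by
      intro x hx
      calc _ ≤ v x * (η + kop μ k v x) := by
            refine mul_le_mul_of_nonneg_left ?_ (hv0 x).le
            have e2 := hB.mul_setIntegral_le_kop hk (j := j) hv (fun y => (hv0 y).le) hx
            have e3 := mul_le_mul_of_nonneg_right (htT i j hij) (hM j).le
            linarith
        _ = 1 := h x
    have e2 : (∫ x in B i, v x ∂μ) * (t * ∫ y in B j, v y ∂μ) ≤ 1 := by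
      rw [← integral_mul_const]
      calc _ ≤ ∫ _ in B i, (1 : ℝ) ∂μ :=
            setIntegral_mono_on (hv.integrable.mul_const _).integrableOn
              (integrable_const _).integrableOn (hB.measurableSet i) e1
        _ ≤ 1 := by
          rw [setIntegral_const, smul_eq_mul, mul_one]
          exact measureReal_le_one
    rw [hQ, le_div_iff₀ ht]
    calc _ = K ^ 2 * ((∫ x in B i, v x ∂μ) * (t * ∫ y in B j, v y ∂μ)) := by
          simp only [hNdef]
          ring
      _ ≤ K ^ 2 := mul_le_of_le_one_right (by positivity) e2
  have hlogm : Measurable fun x => Real.log (v x) := Real.measurable_log.comp hv.1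
  have hlogi : Integrable (fun x => Real.log (v x)) μ := by
    obtain ⟨mv, D, hD⟩ := hv
    refine Integrable.of_bound hlogm.aestronglyMeasurable (max |Real.log c| |Real.log D|)
      (ae_of_all _ fun x => ?_)
    exact abs_le_max_abs_abs (Real.log_le_log hc (hcv x))
      (Real.log_le_log (hv0 x) ((le_abs_self _).trans (hD x)))
  -- Jensen on a block of mass `1/K`, obtained from `log s ≤ s - 1` at `s = v / N i`.
  have h2 : ∀ i, ∫ x in B i, Real.log (v x) ∂μ ≤ (K : ℝ)⁻¹ * Real.log (N i) := by
    intro i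
    calc _ ≤ ∫ x in B i, ((N i)⁻¹ * v x + (Real.log (N i) - 1)) ∂μ := by
          refine setIntegral_mono_on hlogi.integrableOn ((hv.integrable.const_mul _).add
            (integrable_const _)).integrableOn (hB.measurableSet i) fun x _ => ?_
          have e1 := Real.log_le_sub_one_of_pos (mul_pos (inv_pos.2 (hN i)) (hv0 x))
          rw [Real.log_mul (inv_pos.2 (hN i)).ne' (hv0 x).ne', Real.log_inv] at e1
          linarith
      _ = (K : ℝ)⁻¹ * Real.log (N i) := by
          rw [integral_add (hv.integrable.const_mul _).integrableOn
            (integrable_const _).integrableOn, integral_const_mul, setIntegral_const,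
            hB.measureReal_eq, smul_eq_mul]
          have e2 : (N i)⁻¹ * ∫ x in B i, v x ∂μ = (K : ℝ)⁻¹ := by
            have := (hM i).ne'
            simp only [hNdef]
            field_simp
          rw [e2]
          ring
  have h3 : p ≤ ∏ i, N i := by
    rw [hp, ← Real.le_log_iff_exp_le (Finset.prod_pos fun i _ => hN i),
      Real.log_prod fun i _ => (hN i).ne']
    have e1 := Finset.sum_le_sum fun i (_ : i ∈ Finset.univ) => h2 i
    rw [hB.sum_setIntegral hlogi, ← Finset.mul_sum] at e1
    have e2 := le_integral_log hk hA1 hC1 hC hη hc hv hcv h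
    have e3 : -((C + 2) / 2) ≤ (K : ℝ)⁻¹ * ∑ i, Real.log (N i) := by linarith
    have e4 := mul_le_mul_of_nonneg_left e3 hK.le
    rw [mul_inv_cancel_left₀ hK.ne'] at e4
    linarith
  have h4 := hB.indecomposable.le_of_mul_le hN (Real.exp_pos _) (by positivity) h1 h3
  rw [← hB.sum_setIntegral hv.integrable]
  have h5 : ∀ i ∈ Finset.univ, ∫ x in B i, v x ∂μ ≤ (K : ℝ)⁻¹ * (Q / √(p ^ 2 / Q ^ (K - 1))) := by
    intro i _
    rw [inv_mul_eq_div, le_div_iff₀ hK, mul_comm]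
    exact h4 i
  refine (Finset.sum_le_sum h5).trans_eq ?_
  rw [Finset.sum_const, Finset.card_univ, Fintype.card_fin, nsmul_eq_mul,
    mul_inv_cancel_left₀ hK.ne']

/-- For `a = 0` the equation is invariant under `(z, u) ↦ (-z̄, -ū)`, which fixes the imaginary
axis; uniqueness forces `u = -ū`. -/
theorem IsSolutionAt.re_eq_zero {η : ℝ} {u : BB X}
    (hu : IsSolutionAt S 0 (η * Complex.I) u) (hk : IsSmoothingWithKernel μ S k) (hη : 0 < η)
    (x : X) : (u x).re = 0 := by
  have hm : BddMeas fun x => -conj (u x) := by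
    refine ⟨(Complex.continuous_conj.measurable.comp u.2).neg, ‖u‖, fun x => ?_⟩
    rw [norm_neg, Complex.norm_conj]
    exact BB.norm_apply_le u x
  have hS : ∀ x, S (ofFun fun x => -conj (u x)) x = -conj (S u x) := by
    intro x
    apply Complex.ext
    · rw [hk.re_apply, Complex.neg_re, Complex.conj_re, hk.re_apply]
      simp [ofFun_apply hm, kop, integral_neg]
    · rw [hk.im_apply, Complex.neg_im, Complex.conj_im, hk.im_apply]
      simp [ofFun_apply hm]
  have hsol : IsSolutionAt S 0 (η * Complex.I) (ofFun fun x => -conj (u x)) := by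
    intro x
    rw [hS, ofFun_apply hm]
    refine ⟨by simpa using (hu x).1, ?_⟩
    have h1 := congrArg conj (hu x).2
    simp only [map_neg, map_add, map_div₀, map_one, map_mul, Complex.conj_ofReal, Complex.conj_I,
      BB.zero_apply, add_zero] at h1 ⊢
    have e : -(1 / -conj (u x)) = -(-(1 / conj (u x))) := by rw [div_neg]
    rw [e, h1]
    ring
  have hre : IsRealValued (0 : BB X) := fun x => by simp
  have h2 := IsSolutionAt.unique hk hre (by simpa using hη) hu hsol
  have h3 := congrArg (fun w : BB X => (w x).re) h2
  simp only [ofFun_apply hm, Complex.neg_re, Complex.conj_re] at h3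
  have h4 : (u x).re = -(u x).re := h3
  linarith

/-- The solution on the imaginary axis is `i v` with `v` uniformly bounded from above and below. -/
theorem IsBlockBound.exists_bound_imaginary (hB : IsBlockBound μ k T B)
    (hk : IsSmoothingWithKernel μ S k) (hA1 : IsSymmetricPositive μ S)
    (hOut : NoOutliers μ k (0 : BB X)) : ∃ c C : ℝ, 0 < c ∧ 0 < C ∧ ∀ η : ℝ, 0 < η → η ≤ 1 →
      ∃ v : X → ℝ, BddMeas v ∧ (∀ x, c ≤ v x) ∧ (∀ x, v x ≤ C) ∧
        ∀ x, v x * (η + kop μ k v x) = 1 := by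
  obtain ⟨C₁, hC₁⟩ := hB.exists_integral_le hk hA1
  have hre : IsRealValued (0 : BB X) := fun x => by simp
  obtain ⟨C₀, hC₀⟩ := exists_bound_of_integral_le hk hA1 hre hOut
    (hB.isUniformlyPrimitive hk hA1) 1 C₁
  obtain ⟨D, hD1, hD⟩ := hk.exists_sq_bound
  have hC0 : 0 < max C₀ 1 := lt_max_of_lt_right one_pos
  -- The lower bound follows from the upper one through `v = 1/(η + Sv)` with `η ≤ 1` and `S1 ≤ D`.
  refine ⟨(1 + max C₀ 1 * D)⁻¹, max C₀ 1, by positivity, hC0, fun η hη hη1 => ?_⟩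
  have hz : 0 < ((η : ℂ) * Complex.I).im := by simpa using hη
  obtain ⟨u, hu⟩ := exists_isSolutionAt (S := S) (a := 0) hk hre hz
  have hnorm : ∀ x, ‖u x‖ = (u x).im := by
    intro x
    have e : u x = ((u x).im : ℂ) * Complex.I := by
      apply Complex.ext
      · simpa using hu.re_eq_zero hk hη x
      · simp
    have e2 : ‖((u x).im : ℂ) * Complex.I‖ = (u x).im := by
      rw [norm_mul, Complex.norm_I, mul_one, Complex.norm_real, Real.norm_of_nonneg (hu x).1.le]
    exact (congrArg norm e).trans e2
  have heq : ∀ x, (u x).im * (η + kop μ k (fun y => (u y).im) x) = 1 := by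
    intro x
    have h1 := hu.im_eq hk hre x
    rw [hnorm, show ((η : ℂ) * Complex.I).im = η by simp] at h1
    have h2 := (hu x).1
    refine mul_left_cancel₀ h2.ne' ?_
    rw [mul_one, ← mul_assoc, ← sq]
    exact h1.symm
  obtain ⟨c, hc, hcu⟩ := hu.exists_le_im hk hre hz
  have hint : ∫ x, ‖u x‖ ∂μ ≤ C₁ := by
    simp only [hnorm]
    exact hC₁ η hη hη1 c hc _ u.bddMeas.im hcu heq
  have hle : ‖u‖ ≤ max C₀ 1 := (hC₀ _ u hz hu (by simpa [abs_of_pos hη] using hη1) hint).trans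
    (le_max_left _ _)
  have hv : ∀ x, (u x).im ≤ max C₀ 1 := fun x =>
    (Complex.im_le_norm _).trans ((BB.norm_apply_le u x).trans hle)
  refine ⟨fun x => (u x).im, u.bddMeas.im, fun x => ?_, hv, heq⟩
  have h1 : kop μ k (fun y => (u y).im) x ≤ max C₀ 1 * D := by
    calc _ ≤ kop μ k (fun _ => max C₀ 1 * 1) x :=
          hk.kop_mono u.bddMeas.im (BddMeas.const _) (fun y => by simpa using hv y) x
      _ = max C₀ 1 * kop μ k (fun _ => 1) x := kop_const_mul _ _ _
      _ ≤ _ := mul_le_mul_of_nonneg_left (hk.kop_one_le hD1 hD x) hC0.le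
  rw [inv_le_iff_one_le_mul₀ (by positivity)]
  calc 1 = (u x).im * (η + kop μ k (fun y => (u y).im) x) := (heq x).symm
    _ ≤ _ := mul_le_mul_of_nonneg_left (by linarith) (hu x).1.le

end ImaginaryAxis

/-! ### Right inverses of `1 + K` in a Banach space -/

section Abstract

theorem exists_fixedPoint_of_half_lipschitz {E : Type*} [NormedAddCommGroup E] [CompleteSpace E] {F : E → E} {ε : ℝ} (hε : 0 ≤ ε)
    (hF : ∀ h, ‖h‖ ≤ ε → ‖F h‖ ≤ ε)
    (hL : ∀ h h', ‖h‖ ≤ ε → ‖h'‖ ≤ ε → ‖F h - F h'‖ ≤ 1 / 2 * ‖h - h'‖) :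
    ∃ h, ‖h‖ ≤ ε ∧ F h = h := by
  have hs : IsComplete (Metric.closedBall (0 : E) ε) := Metric.isClosed_closedBall.isComplete
  have hm : MapsTo F (Metric.closedBall (0 : E) ε) (Metric.closedBall (0 : E) ε) := by
    intro h hh
    rw [mem_closedBall_zero_iff] at hh ⊢
    exact hF h hh
  have hc : ContractingWith (1 / 2) (hm.restrict F _ _) := by
    refine ⟨by rw [← NNReal.coe_lt_coe]; norm_num, LipschitzWith.of_dist_le_mul fun x y => ?_⟩
    rw [Subtype.dist_eq, Subtype.dist_eq, dist_eq_norm, dist_eq_norm]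
    exact_mod_cast hL x y (mem_closedBall_zero_iff.1 x.2) (mem_closedBall_zero_iff.1 y.2)
  obtain ⟨h, hh, hfix, -⟩ := hc.exists_fixedPoint' hs hm (x := 0) (by simpa using hε)
    (edist_ne_top _ _)
  exact ⟨h, mem_closedBall_zero_iff.1 hh, hfix⟩

variable {E : Type*} [NormedAddCommGroup E] [NormedSpace ℂ E]

/-- The operator `A` minus a rank-one operator compensating its leading part. -/
noncomputable def rankOnePerturbation (A : E →L[ℂ] E) (l : E →L[ℂ] ℂ) (e : E) (ρ : ℝ) :
    E →L[ℂ] E :=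
  A - l.smulRight (((ρ / 2 : ℝ) : ℂ) • (e + A e))

theorem rankOnePerturbation_apply (A : E →L[ℂ] E) (l : E →L[ℂ] ℂ) (e : E) (ρ : ℝ) (w : E) :
    rankOnePerturbation A l e ρ w = A w - l w • ((ρ / 2 : ℝ) : ℂ) • (e + A e) := rfl

/-- Neumann series. A right inverse suffices throughout, since only existence of the perturbed
solution is taken from it. -/
theorem exists_right_inverse_one_add [CompleteSpace E] {R : E →L[ℂ] E} {q : ℝ}
    (hq0 : 0 ≤ q) (hq : q < 1) (hR : ∀ w, ‖R w‖ ≤ q * ‖w‖) :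
    ∃ G : E →L[ℂ] E, (∀ f, ‖G f‖ ≤ (1 - q)⁻¹ * ‖f‖) ∧ ∀ f, G f + R (G f) = f := by
  have hn : ‖-R‖ < 1 := by
    rw [norm_neg]
    exact (R.opNorm_le_bound hq0 hR).trans_lt hq
  set U := Units.oneSub (-R) hn with hU
  have h1 : ∀ f, (↑U⁻¹ : E →L[ℂ] E) f + R ((↑U⁻¹ : E →L[ℂ] E) f) = f := by
    intro f
    have h := congrArg (fun T : E →L[ℂ] E => T f) U.mul_inv
    have h2 : (U : E →L[ℂ] E) = 1 - -R := rfl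
    rw [h2] at h
    simpa using h
  refine ⟨(↑U⁻¹ : E →L[ℂ] E), fun f => ?_, h1⟩
  have h2 := h1 f
  have h3 : ‖(↑U⁻¹ : E →L[ℂ] E) f‖ ≤ ‖f‖ + q * ‖(↑U⁻¹ : E →L[ℂ] E) f‖ := by
    calc _ = ‖f - R ((↑U⁻¹ : E →L[ℂ] E) f)‖ := by
          congr 1
          exact eq_sub_of_add_eq h2
      _ ≤ _ := (norm_sub_le _ _).trans (add_le_add_right (hR _) _)
  rw [inv_mul_eq_div, le_div_iff₀ (by linarith)]
  linarith

theorem norm_pow_apply_le {K : E →L[ℂ] E} (hK : ∀ u, ‖K u‖ ≤ ‖u‖) (n : ℕ) (u : E) :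
    ‖(K ^ n) u‖ ≤ ‖u‖ := by
  induction n with
  | zero => simp
  | succ n ih =>
    rw [clm_pow_succ_apply']
    exact (hK _).trans ih

/-- If an odd power of the contraction `K` is, up to a rank-one operator, a strict contraction,
then `1 + K` has a bounded right inverse. -/
theorem exists_right_inverse_of_odd_pow [CompleteSpace E] {K : E →L[ℂ] E}
    (hK : ∀ u, ‖K u‖ ≤ ‖u‖) {n : ℕ} (hn : Odd n) {l : E →L[ℂ] ℂ} (hl : ∀ u, ‖l u‖ ≤ ‖u‖) {e : E}
    (he : ‖e‖ ≤ 1) {ρ : ℝ} (hρ : 0 < ρ) (hρ1 : ρ ≤ 1)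
    (hR : ∀ w, ‖rankOnePerturbation (K ^ n) l e ρ w‖ ≤ (1 - ρ) * ‖w‖) :
    ∃ G : E →L[ℂ] E, (∀ f, ‖G f‖ ≤ n * (2 * ρ⁻¹) * ‖f‖) ∧ ∀ f, G f + K (G f) = f := by
  obtain ⟨G₀, hG₀, hG₀'⟩ := exists_right_inverse_one_add (by linarith) (by linarith) hR
  -- The rank-one term was chosen so that, with `A = K^n` and `R` its perturbation, `1 + R = (1 +
  -- A)(1 - (ρ/2) l ⊗ e)`; hence a right inverse of `1 + R` gives one of `1 + A`.
  set G₁ : E →L[ℂ] E := (1 - l.smulRight (((ρ / 2 : ℝ) : ℂ) • e)) * G₀ with hG₁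
  have hG₁a : ∀ f, G₁ f = G₀ f - l (G₀ f) • ((ρ / 2 : ℝ) : ℂ) • e := fun f => rfl
  have h1 : ∀ f, G₁ f + (K ^ n) (G₁ f) = f := by
    intro f
    conv_rhs => rw [← hG₀' f]
    rw [rankOnePerturbation_apply, hG₁a]
    simp only [map_sub, map_smul, smul_add]
    abel
  have h2 : ∀ f, ‖G₁ f‖ ≤ 2 * ρ⁻¹ * ‖f‖ := by
    intro f
    have e1 : ‖l (G₀ f) • ((ρ / 2 : ℝ) : ℂ) • e‖ ≤ ‖G₀ f‖ := by
      rw [norm_smul, norm_smul, Complex.norm_real, Real.norm_of_nonneg (by positivity)]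
      calc _ ≤ ‖G₀ f‖ * (1 * 1) := by
            gcongr
            · exact hl _
            · linarith
        _ = _ := by ring
    have e2 := hG₀ f
    rw [sub_sub_cancel] at e2
    rw [hG₁a]
    refine (norm_sub_le _ _).trans ?_
    linarith
  set G₂ : E →L[ℂ] E := ∑ i ∈ Finset.range n, (-K) ^ i with hG₂
  -- Here `n` odd is essential: the geometric sum of `-K` then factors `1 + K^n`, not `1 - K^n`.
  have h3 : (1 + K) * G₂ = 1 + K ^ n := by
    have := mul_neg_geom_sum (-K) n
    rwa [sub_neg_eq_add, hn.neg_pow, sub_neg_eq_add] at this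
  refine ⟨G₂ * G₁, fun f => ?_, fun f => ?_⟩
  · have e1 : ‖G₂ (G₁ f)‖ ≤ n * ‖G₁ f‖ := by
      rw [hG₂, sum_apply]
      refine (norm_sum_le _ _).trans ?_
      calc _ ≤ ∑ _i ∈ Finset.range n, ‖G₁ f‖ :=
            Finset.sum_le_sum fun i _ => norm_pow_apply_le (K := -K)
              (fun u => by simpa using hK u) i (G₁ f)
        _ = _ := by simp
    calc _ ≤ n * ‖G₁ f‖ := e1
      _ ≤ n * (2 * ρ⁻¹ * ‖f‖) := by
        gcongr
        exact h2 f
      _ = _ := by ring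
  · have e1 := congrArg (fun T : E →L[ℂ] E => T (G₁ f)) h3
    simp only [mul_apply_eq_comp, add_apply,
      one_apply_eq_self] at e1
    rw [mul_apply_eq_comp, e1]
    exact h1 f

end Abstract

/-! ### Positivity preserving operators -/

section PositiveOperators

variable {X : Type*} [MeasurableSpace X]

/-- The constant function `1`. -/
noncomputable def oneBB : BB X := ofFun fun _ => ((1 : ℝ) : ℂ)

theorem oneBB_apply (x : X) : (oneBB : BB X) x = 1 := by
  rw [oneBB, ofFun_apply (BddMeas.const (1 : ℝ)).ofReal, Complex.ofReal_one]

theorem norm_oneBB_le : ‖(oneBB : BB X)‖ ≤ 1 :=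
  BB.norm_le zero_le_one fun x => by rw [oneBB_apply, norm_one]

theorem isNonneg_oneBB : IsNonneg (oneBB : BB X) :=
  isNonneg_ofFun (BddMeas.const 1) fun _ => zero_le_one

/-- Multiplication by a bounded measurable function. -/
noncomputable def mulOp (w : BB X) : BB X →L[ℂ] BB X :=
  LinearMap.mkContinuous
    { toFun := fun u => ofFun fun x => w x * u x
      map_add' := fun u u' => BB.ext fun x => by
        rw [BB.add_apply, ofFun_apply (w.bddMeas.mul u.bddMeas),
          ofFun_apply (w.bddMeas.mul u'.bddMeas), ofFun_apply (w.bddMeas.mul (u + u').bddMeas)]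
        exact mul_add _ _ _
      map_smul' := fun c u => BB.ext fun x => by
        rw [BB.smul_apply, ofFun_apply (w.bddMeas.mul u.bddMeas),
          ofFun_apply (w.bddMeas.mul (c • u).bddMeas)]
        exact mul_left_comm _ _ _ }
    ‖w‖ fun u => BB.norm_le (by positivity) fun x => by
      have h : ofFun (fun x => w x * u x) x = w x * u x :=
        ofFun_apply (w.bddMeas.mul u.bddMeas) x
      refine (congrArg norm h).trans_le ?_
      rw [norm_mul]
      exact mul_le_mul (BB.norm_apply_le w x) (BB.norm_apply_le u x) (norm_nonneg _)
        (norm_nonneg _)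

theorem mulOp_apply (w u : BB X) (x : X) : mulOp w u x = w x * u x :=
  ofFun_apply (w.bddMeas.mul u.bddMeas) x

/-- The average as a continuous linear functional. -/
noncomputable def avgL (μ : Measure X) [IsProbabilityMeasure μ] : BB X →L[ℂ] ℂ :=
  LinearMap.mkContinuous
    { toFun := avg μ
      map_add' := fun u w => integral_add u.bddMeas.integrable w.bddMeas.integrable
      map_smul' := fun c _ => integral_const_mul c _ }
    1 fun u => by
      rw [one_mul]
      refine (norm_integral_le_of_norm_le_const (ae_of_all _ (BB.norm_apply_le u))).trans ?_
      simp

theorem norm_avgL_le (μ : Measure X) [IsProbabilityMeasure μ] (u : BB X) : ‖avgL μ u‖ ≤ ‖u‖ := by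
  refine (norm_integral_le_of_norm_le_const (ae_of_all _ (BB.norm_apply_le u))).trans ?_
  simp

/-- Apply `P` to the non-negative function `C · 1 - f`; this yields both reality of `P f` and the
bound. -/
theorem apply_of_isRealValued {P : BB X →L[ℂ] BB X} (hP : ∀ u, IsNonneg u → IsNonneg (P u))
    {f : BB X} (hf : IsRealValued f) {C : ℝ} (hC : ∀ x, (f x).re ≤ C) (x : X) :
    (P f x).im = 0 ∧ (P f x).re ≤ C * (P oneBB x).re := by
  have h1 : IsNonneg ((C : ℂ) • oneBB - f) := by
    intro y
    rw [BB.sub_apply, BB.smul_apply, oneBB_apply, mul_one]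
    simpa [hf y] using hC y
  have h2 := hP _ h1 x
  have h3 := hP _ isNonneg_oneBB x
  rw [P.map_sub, P.map_smul, BB.sub_apply, BB.smul_apply] at h2
  simp only [Complex.sub_im, Complex.sub_re, Complex.re_ofReal_mul, Complex.im_ofReal_mul] at h2
  rw [h3.1] at h2
  constructor
  · linarith [h2.1]
  · linarith [h2.2]

/-- A positivity preserving operator is controlled by its value on the constant function. -/
theorem norm_apply_le_of_isNonneg {P : BB X →L[ℂ] BB X} (hP : ∀ u, IsNonneg u → IsNonneg (P u))
    (w : BB X) (x : X) : ‖P w x‖ ≤ ‖w‖ * (P oneBB x).re := by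
  -- Rotate `w` so that `P w x` becomes real and non-negative; then only the real part of the
  -- rotated function contributes.
  obtain ⟨c, hc, hcw⟩ := Complex.exists_norm_eq_mul_self (P w x)
  set w' := c • w with hw'
  have hw'n : ∀ y, ‖w' y‖ ≤ ‖w‖ := by
    intro y
    rw [hw', BB.smul_apply, norm_mul, hc, one_mul]
    exact BB.norm_apply_le w y
  set f : BB X := ofFun fun y => ((w' y).re : ℂ) with hf
  set g : BB X := ofFun fun y => ((w' y).im : ℂ) with hg
  have hfa : ∀ y, f y = ((w' y).re : ℂ) := ofFun_apply w'.bddMeas.re.ofReal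
  have hga : ∀ y, g y = ((w' y).im : ℂ) := ofFun_apply w'.bddMeas.im.ofReal
  have hdec : w' = f + Complex.I • g := BB.ext fun y => by
    have e : (f + Complex.I • g) y = f y + Complex.I * g y := rfl
    rw [e, hfa, hga, mul_comm]
    exact (Complex.re_add_im (w' y)).symm
  have h1 := apply_of_isRealValued hP (f := f) (fun y => by rw [hfa, Complex.ofReal_im])
    (fun y => by
      rw [hfa, Complex.ofReal_re]
      exact (Complex.re_le_norm _).trans (hw'n y)) x
  have h2 := apply_of_isRealValued hP (f := g) (fun y => by rw [hga, Complex.ofReal_im])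
    (fun y => by
      rw [hga, Complex.ofReal_re]
      exact (Complex.im_le_norm _).trans (hw'n y)) x
  have h3 : ((‖P w x‖ : ℝ) : ℂ) = P f x + Complex.I * P g x := by
    rw [hcw, ← BB.smul_apply, ← P.map_smul, ← hw', hdec, P.map_add, P.map_smul, BB.add_apply,
      BB.smul_apply]
  have h4 := congrArg Complex.re h3
  rw [Complex.ofReal_re, Complex.add_re, Complex.I_mul_re, h2.1, neg_zero, add_zero] at h4
  rw [h4]
  exact h1.2

theorem isNonneg_pow {P : BB X →L[ℂ] BB X} (hP : ∀ u, IsNonneg u → IsNonneg (P u)) (n : ℕ)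
    {u : BB X} (hu : IsNonneg u) : IsNonneg ((P ^ n) u) := by
  induction n with
  | zero => exact hu
  | succ n ih =>
    rw [clm_pow_succ_apply']
    exact hP _ ih

variable {μ : Measure X}

theorem avg_eq_of_isNonneg {u : BB X} (hu : IsNonneg u) : avg μ u = ((avg μ u).re : ℂ) := by
  have h : avg μ u = ((∫ x, (u x).re ∂μ : ℝ) : ℂ) := by
    conv_lhs => rw [hu.eq_ofFun]
    exact avg_ofFun u.bddMeas.re
  rw [h, Complex.ofReal_re]

variable [IsProbabilityMeasure μ]

theorem norm_rankOnePerturbation_le {A : BB X →L[ℂ] BB X} (hA : ∀ u, IsNonneg u → IsNonneg (A u))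
    (hA1 : ∀ x, (A oneBB x).re ≤ 1) {ρ : ℝ} (hρ : 0 < ρ) (hρ1 : ρ ≤ 1)
    (hprim : ∀ u : BB X, IsNonneg u → ∀ x, ρ * (avg μ u).re ≤ (A u x).re) (w : BB X) :
    ‖rankOnePerturbation A (avgL μ) oneBB ρ w‖ ≤ (1 - ρ) * ‖w‖ := by
  have havg1 : avg μ (oneBB : BB X) = 1 := by
    rw [oneBB, avg_ofFun (BddMeas.const 1)]
    simp
  have hRa : ∀ u : BB X, IsNonneg u → ∀ x, rankOnePerturbation A (avgL μ) oneBB ρ u x =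
      (((A u x).re - (avg μ u).re * (ρ / 2 * (1 + (A oneBB x).re)) : ℝ) : ℂ) := by
    intro u hu x
    have e1 : A u x = ((A u x).re : ℂ) := Complex.ext rfl (hA u hu x).1
    have e2 : A oneBB x = ((A oneBB x).re : ℂ) := Complex.ext rfl (hA _ isNonneg_oneBB x).1
    have e3 : rankOnePerturbation A (avgL μ) oneBB ρ u x =
      A u x - avg μ u * (((ρ / 2 : ℝ) : ℂ) * ((oneBB : BB X) x + A oneBB x)) := rfl
    rw [e3, oneBB_apply, avg_eq_of_isNonneg hu]
    refine (congrArg₂ (fun s t : ℂ => s - ((avg μ u).re : ℂ) * (((ρ / 2 : ℝ) : ℂ) * (1 + t)))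
      e1 e2).trans ?_
    push_cast
    rfl
  have hpos : ∀ u, IsNonneg u → IsNonneg (rankOnePerturbation A (avgL μ) oneBB ρ u) := by
    intro u hu x
    rw [hRa u hu x]
    refine ⟨Complex.ofReal_im _, ?_⟩
    rw [Complex.ofReal_re]
    have e1 := hprim u hu x
    have e2 : 0 ≤ (avg μ u).re := by
      rw [re_avg]
      exact integral_nonneg fun x => (hu x).2
    -- Since `A1 ≤ 1`, the subtracted weight `(ρ/2)(1 + A1)` is at most `ρ`, which primitivity
    -- allows.
    have e3 := mul_nonneg (mul_nonneg e2 hρ.le) (sub_nonneg.2 (hA1 x))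
    linarith
  refine BB.norm_le (mul_nonneg (by linarith) (norm_nonneg _)) fun x => ?_
  refine (norm_apply_le_of_isNonneg hpos w x).trans ?_
  rw [mul_comm (1 - ρ)]
  refine mul_le_mul_of_nonneg_left ?_ (norm_nonneg _)
  rw [hRa _ isNonneg_oneBB x, Complex.ofReal_re, havg1, Complex.one_re]
  have e3 := mul_le_mul_of_nonneg_left (hA1 x) (by linarith : 0 ≤ 1 - ρ / 2)
  linarith

/-- `1 + P` is boundedly invertible for a sub-Markovian operator `P` with a primitive odd power. -/
theorem exists_right_inverse_of_primitive {P : BB X →L[ℂ] BB X}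
    (hP : ∀ u, IsNonneg u → IsNonneg (P u)) (hP1 : ∀ x, (P oneBB x).re ≤ 1) {n : ℕ} (hn : Odd n)
    {ρ : ℝ} (hρ : 0 < ρ)
    (hprim : ∀ u : BB X, IsNonneg u → ∀ x, ρ * (avg μ u).re ≤ ((P ^ n) u x).re) :
    ∃ G : BB X →L[ℂ] BB X, (∀ f, ‖G f‖ ≤ n * (2 * ρ⁻¹) * ‖f‖) ∧ ∀ f, G f + P (G f) = f := by
  have hnorm : ∀ u, ‖P u‖ ≤ ‖u‖ := fun u => BB.norm_le (norm_nonneg _) fun x =>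
    (norm_apply_le_of_isNonneg hP u x).trans (mul_le_of_le_one_right (norm_nonneg _) (hP1 x))
  have hA1 : ∀ x, ((P ^ n) oneBB x).re ≤ 1 := fun x => (Complex.re_le_norm _).trans
    ((BB.norm_apply_le _ x).trans ((norm_pow_apply_le hnorm n _).trans norm_oneBB_le))
  obtain ⟨x₀⟩ : Nonempty X := μ.nonempty_of_neZero
  have hρ1 : ρ ≤ 1 := by
    have h1 := hprim _ isNonneg_oneBB x₀
    rw [oneBB, avg_ofFun (BddMeas.const 1), Complex.ofReal_re] at h1
    simp only [integral_const, probReal_univ, smul_eq_mul, mul_one] at h1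
    exact h1.trans (hA1 x₀)
  exact exists_right_inverse_of_odd_pow hnorm hn (norm_avgL_le μ) norm_oneBB_le hρ hρ1
    (norm_rankOnePerturbation_le (fun u hu => isNonneg_pow hP n hu) hA1 hρ hρ1 hprim)

end PositiveOperators

/-! ### Fixed point argument for the perturbed equation -/

section Abstract

/-- A perturbation `h + P h = Q h + g` of a linear equation with small nonlinearity `Q` has a
small solution. -/
theorem exists_solution_perturbed {E : Type*} [NormedAddCommGroup E] [NormedSpace ℂ E]
    [CompleteSpace E] {P G : E →L[ℂ] E} {Q : E → E} {Γ ε : ℝ} (hΓ : 0 < Γ)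
    (hG : ∀ f, ‖G f‖ ≤ Γ * ‖f‖) (hPG : ∀ f, G f + P (G f) = f) (hε0 : 0 < ε)
    (hεΓ : 20 * (Γ * ε) ≤ 1) (hQ0 : Q 0 = 0)
    (hQ : ∀ h h', ‖h‖ ≤ ε → ‖h'‖ ≤ ε → ‖Q h - Q h'‖ ≤ 10 * ε * ‖h - h'‖) {g : E}
    (hg : 2 * (Γ * ‖g‖) ≤ ε) : ∃ h : E, ‖h‖ ≤ ε ∧ h + P h = Q h + g := by
  have hL : ∀ h h' : E, ‖h‖ ≤ ε → ‖h'‖ ≤ ε →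
      ‖G (Q h + g) - G (Q h' + g)‖ ≤ 1 / 2 * ‖h - h'‖ := by
    intro h h' hh hh'
    rw [← map_sub, add_sub_add_right_eq_sub]
    refine (hG _).trans ?_
    calc _ ≤ Γ * (10 * ε * ‖h - h'‖) := by
          gcongr
          exact hQ h h' hh hh'
      _ = 10 * (Γ * ε) * ‖h - h'‖ := by ring
      _ ≤ _ := by
        gcongr
        linarith
  obtain ⟨h, hh, hfix⟩ := exists_fixedPoint_of_half_lipschitz (F := fun h => G (Q h + g)) hε0.le
    (fun h hh => by
      have e1 := hL h 0 hh (by simpa using hε0.le)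
      rw [hQ0, zero_add, sub_zero] at e1
      have e2 := hG g
      calc ‖G (Q h + g)‖ = ‖(G (Q h + g) - G g) + G g‖ := by rw [sub_add_cancel]
        _ ≤ 1 / 2 * ‖h‖ + Γ * ‖g‖ := (norm_add_le _ _).trans (add_le_add e1 e2)
        _ ≤ ε := by linarith)
    hL
  refine ⟨h, hh, ?_⟩
  have e1 := hPG (Q h + g)
  rwa [hfix] at e1

end Abstract

/-! ### Case (i): leaving the imaginary axis -/

section Stability

variable {X : Type*} [MeasurableSpace X] {μ : Measure X} [IsProbabilityMeasure μ]
  {S : BB X →L[ℂ] BB X} {k : X → X → ℝ}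

/-- The operator `u ↦ v S (v u)`. -/
noncomputable def weightedOp (S : BB X →L[ℂ] BB X) (v : X → ℝ) : BB X →L[ℂ] BB X :=
  (mulOp (ofFun fun x => (v x : ℂ))).comp (S.comp (mulOp (ofFun fun x => (v x : ℂ))))

theorem weightedOp_apply (v : X → ℝ) (hv : BddMeas v) (u : BB X) (x : X) :
    weightedOp S v u x = v x * S (mulOp (ofFun fun x => (v x : ℂ)) u) x := by
  have h : weightedOp S v u x = ofFun (fun x => (v x : ℂ)) x *
    S (mulOp (ofFun fun x => (v x : ℂ)) u) x := mulOp_apply _ _ x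
  rw [h, ofFun_apply hv.ofReal]

theorem mulOp_ofFun_apply {v : X → ℝ} (hv : BddMeas v) (u : BB X) (x : X) :
    mulOp (ofFun fun x => (v x : ℂ)) u x = v x * u x := by
  rw [mulOp_apply, ofFun_apply hv.ofReal]

theorem re_weightedOp (hk : IsSmoothingWithKernel μ S k) {v : X → ℝ} (hv : BddMeas v) (u : BB X)
    (x : X) : (weightedOp S v u x).re = v x * kop μ k (fun y => v y * (u y).re) x := by
  rw [weightedOp_apply v hv, Complex.re_ofReal_mul, hk.re_apply]
  simp only [mulOp_ofFun_apply hv, Complex.re_ofReal_mul]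

theorem im_weightedOp (hk : IsSmoothingWithKernel μ S k) {v : X → ℝ} (hv : BddMeas v) (u : BB X)
    (x : X) : (weightedOp S v u x).im = v x * kop μ k (fun y => v y * (u y).im) x := by
  rw [weightedOp_apply v hv, Complex.im_ofReal_mul, hk.im_apply]
  simp only [mulOp_ofFun_apply hv, Complex.im_ofReal_mul]

theorem isNonneg_weightedOp (hk : IsSmoothingWithKernel μ S k) {v : X → ℝ} (hv : BddMeas v)
    (hv0 : ∀ x, 0 ≤ v x) {u : BB X} (hu : IsNonneg u) : IsNonneg (weightedOp S v u) := by
  intro x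
  rw [re_weightedOp hk hv, im_weightedOp hk hv]
  refine ⟨?_, mul_nonneg (hv0 x) (kop_nonneg hk (fun y => mul_nonneg (hv0 y) (hu y).2) x)⟩
  have : (fun y => v y * (u y).im) = fun _ => 0 := funext fun y => by rw [(hu y).1, mul_zero]
  rw [this]
  simp [kop]

/-- The kernel `v_x S_xy v_y` dominates `c² S_xy`, so primitivity of `S` passes to `vSv`. -/
theorem re_pow_le_re_weightedOp_pow (hk : IsSmoothingWithKernel μ S k)
    (hA1 : IsSymmetricPositive μ S) {v : X → ℝ} (hv : BddMeas v) {c : ℝ} (hc : 0 < c)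
    (hcv : ∀ x, c ≤ v x) {u : BB X} (hu : IsNonneg u) (n : ℕ) (x : X) :
    (c ^ 2) ^ n * ((S ^ n) u x).re ≤ ((weightedOp S v ^ n) u x).re := by
  have hv0 : ∀ x, 0 ≤ v x := fun x => hc.le.trans (hcv x)
  induction n generalizing x with
  | zero => simp
  | succ n ih =>
    rw [clm_pow_succ_apply', clm_pow_succ_apply', re_weightedOp hk hv, hk.re_apply]
    have hSn := isNonneg_pow hA1.2 n hu
    rw [← kop_const_mul, ← kop_const_mul]
    refine hk.kop_mono ((BddMeas.const _).mul ((S ^ n) u).bddMeas.re)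
      ((BddMeas.const _).mul (hv.mul ((weightedOp S v ^ n) u).bddMeas.re)) (fun y => ?_) x
    have h1 : 0 ≤ (c ^ 2) ^ n * ((S ^ n) u y).re := mul_nonneg (by positivity) (hSn y).2
    have h2 : c * c ≤ v x * v y := mul_le_mul (hcv x) (hcv y) hc.le (hv0 x)
    calc _ = c * c * ((c ^ 2) ^ n * ((S ^ n) u y).re) := by ring
      _ ≤ v x * v y * ((weightedOp S v ^ n) u y).re :=
        mul_le_mul h2 (ih y) h1 (mul_nonneg (hv0 x) (hv0 y))
      _ = _ := by ring

/-- The difference equals `(s - t)(s + t + st) / ((1 + s)(1 + t))`; the numerator factor is at most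
`5ε/2` and the denominator at least `1/4`. -/
theorem norm_quadratic_sub_le {s t : ℂ} {ε : ℝ} (hε : ε ≤ 1 / 2) (hs : ‖s‖ ≤ ε) (ht : ‖t‖ ≤ ε) :
    ‖s ^ 2 / (1 + s) - t ^ 2 / (1 + t)‖ ≤ 10 * ε * ‖s - t‖ := by
  have hlow : ∀ r : ℂ, ‖r‖ ≤ ε → 1 / 2 ≤ ‖1 + r‖ := by
    intro r hr
    have h := norm_sub_norm_le (1 : ℂ) (-r)
    rw [norm_one, norm_neg, sub_neg_eq_add] at h
    linarith
  have h1 := hlow s hs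
  have h2 := hlow t ht
  have n1 : 1 + s ≠ 0 := norm_pos_iff.1 (by linarith)
  have n2 : 1 + t ≠ 0 := norm_pos_iff.1 (by linarith)
  have e : s ^ 2 / (1 + s) - t ^ 2 / (1 + t) = (s - t) * (s + t + s * t) / ((1 + s) * (1 + t)) := by
    field_simp
    ring
  have hε0 : 0 ≤ ε := (norm_nonneg s).trans hs
  have h3 : ‖s + t + s * t‖ ≤ 5 / 2 * ε := by
    refine norm_add₃_le.trans ?_
    rw [norm_mul]
    have : ‖s‖ * ‖t‖ ≤ 1 / 2 * ε := mul_le_mul (hs.trans hε) ht (norm_nonneg _) (by norm_num)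
    linarith
  have h4 : 1 / 4 ≤ ‖1 + s‖ * ‖1 + t‖ := by nlinarith
  rw [e, norm_div, norm_mul, norm_mul, div_le_iff₀ (by linarith)]
  calc ‖s - t‖ * ‖s + t + s * t‖ ≤ ‖s - t‖ * (5 / 2 * ε) := by gcongr
    _ = 10 * ε * ‖s - t‖ * (1 / 4) := by ring
    _ ≤ _ := by gcongr

/-- The function `h ^ 2 / (1 + h)`. -/
noncomputable def quadraticTerm (h : BB X) : BB X := ofFun fun x => h x ^ 2 / (1 + h x)

theorem quadraticTerm_apply {h : BB X} (hh : ‖h‖ ≤ 1 / 2) (x : X) :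
    quadraticTerm h x = h x ^ 2 / (1 + h x) := by
  refine ofFun_apply ⟨(h.2.pow_const 2).div (measurable_const.add h.2), 5 / 2, fun x => ?_⟩ x
  have hx := (BB.norm_apply_le h x).trans hh
  have h1 := norm_quadratic_sub_le (s := h x) (t := 0) le_rfl hx (by simp)
  have e : (0 : ℂ) ^ 2 / (1 + 0) = 0 := by norm_num
  rw [e, sub_zero, sub_zero] at h1
  exact h1.trans (by linarith)

theorem norm_quadraticTerm_sub_le {ε : ℝ} (hε0 : 0 ≤ ε) (hε : ε ≤ 1 / 2) {h h' : BB X}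
    (hh : ‖h‖ ≤ ε) (hh' : ‖h'‖ ≤ ε) :
    ‖quadraticTerm h - quadraticTerm h'‖ ≤ 10 * ε * ‖h - h'‖ := by
  refine BB.norm_le (by positivity) fun x => ?_
  rw [BB.sub_apply, quadraticTerm_apply (hh.trans hε), quadraticTerm_apply (hh'.trans hε)]
  refine (norm_quadratic_sub_le hε ((BB.norm_apply_le h x).trans hh)
    ((BB.norm_apply_le h' x).trans hh')).trans ?_
  exact mul_le_mul_of_nonneg_left (BB.norm_apply_le (h - h') x) (by positivity)

theorem quadraticTerm_zero : quadraticTerm (0 : BB X) = 0 := BB.ext fun x => by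
  have h0 : ‖(0 : BB X)‖ ≤ 1 / 2 := by
    rw [norm_zero]
    norm_num
  rw [quadraticTerm_apply h0, BB.zero_apply]
  norm_num

/-- Pointwise algebra of the ansatz `u = iv(1 + h)`: here `s = h_x`, `κ = (Sv)_x` and `w =
(S(vh))_x`. Clearing denominators in the conclusion and substituting `v(η + κ) = 1` gives `h1`. -/
theorem neg_one_div_eq_of_perturbed {s v w κ η z : ℂ} (hv : v ≠ 0) (hs : 1 + s ≠ 0)
    (h1 : s + v * w = s ^ 2 / (1 + s) + Complex.I * (z - η * Complex.I) * v)
    (h2 : v * (η + κ) = 1) :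
    -(1 / (Complex.I * (v * (1 + s)))) = z + 0 + Complex.I * (κ + w) := by
  have h3 : (s + v * w) * (1 + s) = s ^ 2 + Complex.I * (z - η * Complex.I) * v * (1 + s) := by
    rw [h1, add_mul, div_mul_cancel₀ _ hs]
  rw [← neg_div, div_eq_iff (mul_ne_zero Complex.I_ne_zero (mul_ne_zero hv hs))]
  linear_combination h3 + (1 + s) * h2 - (κ + w + η) * v * (1 + s) * Complex.I_sq

/-- A small solution of the perturbed equation gives a solution of the quadratic vector equation. -/
theorem isSolutionAt_of_perturbed (hk : IsSmoothingWithKernel μ S k) {v : X → ℝ} (hv : BddMeas v)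
    (hv0 : ∀ x, 0 < v x) {η : ℝ} (heq : ∀ x, v x * (η + kop μ k v x) = 1) {z : ℂ} {h : BB X}
    (hh : ‖h‖ ≤ 1 / 2) (hP : ∀ x, h x + weightedOp S v h x =
      h x ^ 2 / (1 + h x) + Complex.I * (z - η * Complex.I) * v x) :
    IsSolutionAt S 0 z (Complex.I • (ofFun (fun x => (v x : ℂ)) +
      mulOp (ofFun fun x => (v x : ℂ)) h)) := by
  set V : BB X := ofFun fun x => (v x : ℂ) with hV
  intro x
  have hVx : V x = v x := ofFun_apply hv.ofReal x
  have hm : (Complex.I • (V + mulOp V h)) x = Complex.I * (v x * (1 + h x)) := by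
    have e : (Complex.I • (V + mulOp V h)) x = Complex.I * (V x + mulOp V h x) := rfl
    rw [e, mulOp_apply, hVx]
    ring
  have hSV : S V x = kop μ k v x := hk.apply_ofReal hv x
  have hSm : S (Complex.I • (V + mulOp V h)) x = Complex.I * (S V x + S (mulOp V h) x) := by
    rw [S.map_smul, S.map_add]
    rfl
  have hhx : ‖h x‖ ≤ 1 / 2 := (BB.norm_apply_le h x).trans hh
  have hv' : (v x : ℂ) ≠ 0 := by exact_mod_cast (hv0 x).ne'
  have h1 : 1 + h x ≠ 0 := by
    intro h0
    have : h x = -1 := by linear_combination h0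
    rw [this, norm_neg, norm_one] at hhx
    norm_num at hhx
  rw [hm, hSm, hSV]
  constructor
  · rw [Complex.I_mul_im, Complex.re_ofReal_mul, Complex.add_re, Complex.one_re]
    have := (abs_le.1 ((Complex.abs_re_le_norm (h x)).trans hhx)).1
    exact mul_pos (hv0 x) (by linarith)
  · have e1 := hP x
    rw [weightedOp_apply v hv] at e1
    have e2 : (v x : ℂ) * (η + kop μ k v x) = 1 := by exact_mod_cast heq x
    exact neg_one_div_eq_of_perturbed hv' h1 e1 e2

/-- In a neighbourhood of the origin the solution is a small perturbation of its values on the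
imaginary axis. -/
theorem IsBlockBound.exists_bound_near_zero {K : ℕ} {T : Matrix (Fin K) (Fin K) ℝ}
    {B : Fin K → Set X} (hB : IsBlockBound μ k T B) (hk : IsSmoothingWithKernel μ S k)
    (hA1 : IsSymmetricPositive μ S) (hOut : NoOutliers μ k (0 : BB X)) :
    ∃ δ C : ℝ, 0 < δ ∧ ∀ (z : ℂ) (u : BB X), 0 < z.im → IsSolutionAt S 0 z u → ‖z‖ ≤ δ →
      ‖u‖ ≤ C := by
  obtain ⟨c, C, hc, hC, hv⟩ := hB.exists_bound_imaginary hk hA1 hOut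
  obtain ⟨n, hn, ρ, hρ, hprim⟩ := hB.exists_odd_pow_lower_bound hk hA1
  obtain ⟨r, hr⟩ : ∃ r, r = (c ^ 2) ^ n * ρ := ⟨_, rfl⟩
  have hr0 : 0 < r := hr ▸ by positivity
  -- `Γ` bounds the right inverse of `1 + vSv`, and `r` is the primitivity constant of `(vSv)^n`.
  -- Both depend only on the bounds for `v`, so `δ` may be chosen after them.
  obtain ⟨Γ, hΓ⟩ : ∃ Γ : ℝ, Γ = n * (2 * r⁻¹) := ⟨_, rfl⟩
  have hn0 : (0 : ℝ) < n := by exact_mod_cast hn.pos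
  have hΓ0 : 0 < Γ := hΓ ▸ by positivity
  -- The quadratic term is `10ε`-Lipschitz, so `20Γε ≤ 1` makes its composition with the right
  -- inverse a `1/2`-contraction.
  obtain ⟨ε, hε⟩ : ∃ ε : ℝ, ε = min (1 / 2) (1 / (20 * Γ)) := ⟨_, rfl⟩
  have hε0 : 0 < ε := by
    rw [hε]
    positivity
  have hε1 : ε ≤ 1 / 2 := hε ▸ min_le_left _ _
  have hε2 : 20 * (Γ * ε) ≤ 1 := by
    have h1 : ε ≤ 1 / (20 * Γ) := hε ▸ min_le_right _ _
    rw [le_div_iff₀ (by positivity)] at h1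
    linarith
  obtain ⟨δ, hδ⟩ : ∃ δ : ℝ, δ = min 1 (ε / (4 * (Γ * C))) := ⟨_, rfl⟩
  have hδ0 : 0 < δ := by
    rw [hδ]
    positivity
  have hδ1 : δ ≤ 1 := hδ ▸ min_le_left _ _
  have hδ2 : 4 * (Γ * C) * δ ≤ ε := by
    have h1 : δ ≤ ε / (4 * (Γ * C)) := hδ ▸ min_le_right _ _
    rw [le_div_iff₀ (by positivity)] at h1
    linarith
  refine ⟨δ, C + C * (1 / 2), hδ0, fun z u hz hu hzδ => ?_⟩
  -- Every `z` in the disc is compared with the single point `iδ`, at distance at most `2δ`; the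
  -- source term then has norm at most `2δC`, and `4ΓCδ ≤ ε` keeps the fixed point in the `ε`-ball.
  obtain ⟨v, hvm, hcv, hvC, heq⟩ := hv δ hδ0 hδ1
  have hv0 : ∀ x, 0 < v x := fun x => hc.trans_le (hcv x)
  have hP1 : ∀ x, (weightedOp S v oneBB x).re ≤ 1 := by
    intro x
    rw [re_weightedOp hk hvm]
    simp only [oneBB_apply, Complex.one_re, mul_one]
    have h1 := heq x
    have h2 := mul_pos (hv0 x) hδ0
    linarith
  obtain ⟨G, hG, hPG⟩ := exists_right_inverse_of_primitive (μ := μ) (P := weightedOp S v)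
    (fun u hu => isNonneg_weightedOp hk hvm (fun x => (hv0 x).le) hu) hP1 hn hr0 (fun u hu x => by
      refine le_trans ?_ (re_pow_le_re_weightedOp_pow hk hA1 hvm hc hcv hu n x)
      rw [hr, mul_assoc]
      exact mul_le_mul_of_nonneg_left (hprim u hu x) (by positivity))
  rw [← hΓ] at hG
  have hVn : ‖ofFun fun x => (v x : ℂ)‖ ≤ C := BB.norm_le hC.le fun x => by
    rw [ofFun_apply hvm.ofReal, Complex.norm_real, Real.norm_of_nonneg (hv0 x).le]
    exact hvC x
  obtain ⟨h, hh, hsol⟩ := exists_solution_perturbed hΓ0 hG hPG hε0 hε2 quadraticTerm_zero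
    (fun h h' => norm_quadraticTerm_sub_le hε0.le hε1)
    (g := (Complex.I * (z - δ * Complex.I)) • ofFun fun x => (v x : ℂ)) (by
      rw [norm_smul, norm_mul, Complex.norm_I, one_mul]
      have h1 : ‖z - δ * Complex.I‖ ≤ 2 * δ := by
        refine (norm_sub_le _ _).trans ?_
        rw [norm_mul, Complex.norm_I, mul_one, Complex.norm_real, Real.norm_of_nonneg hδ0.le]
        linarith
      have h2 := mul_le_mul h1 hVn (norm_nonneg _) (by positivity)
      have h3 := mul_le_mul_of_nonneg_left h2 hΓ0.le
      linarith)
  have hm := isSolutionAt_of_perturbed hk hvm hv0 heq (z := z) (hh.trans hε1) (fun x => by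
    have h1 : h x + weightedOp S v h x = quadraticTerm h x +
        Complex.I * (z - δ * Complex.I) * ofFun (fun x => (v x : ℂ)) x :=
      congrArg (fun w : BB X => w x) hsol
    rwa [quadraticTerm_apply (hh.trans hε1), ofFun_apply hvm.ofReal] at h1)
  have hre : IsRealValued (0 : BB X) := fun x => by simp
  rw [hu.unique hk hre hz hm, norm_smul, Complex.norm_I, one_mul]
  refine (norm_add_le _ _).trans (add_le_add hVn ?_)
  refine BB.norm_le (by positivity) fun x => ?_
  rw [mulOp_apply, norm_mul]
  exact mul_le_mul ((BB.norm_apply_le _ x).trans hVn)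
    ((BB.norm_apply_le h x).trans (hh.trans hε1)) (norm_nonneg _) hC.le

/-- For `a = 0` the L² argument works outside every disc around the origin, in particular outside
the one covered by the perturbation argument. -/
theorem IsBlockBound.exists_bound {K : ℕ} {T : Matrix (Fin K) (Fin K) ℝ}
    {B : Fin K → Set X} (hB : IsBlockBound μ k T B) (hk : IsSmoothingWithKernel μ S k)
    (hA1 : IsSymmetricPositive μ S) (hOut : NoOutliers μ k (0 : BB X)) :
    ∃ C : ℝ, ∀ (z : ℂ) (u : BB X), 0 < z.im → IsSolutionAt S 0 z u → ‖u‖ ≤ C := by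
  obtain ⟨δ, C₁, hδ, h₁⟩ := hB.exists_bound_near_zero hk hA1 hOut
  have hre : IsRealValued (0 : BB X) := fun x => by simp
  obtain ⟨C₂, h₂⟩ := exists_bound_of_le_norm hk hA1 hre hOut hδ
  refine ⟨max C₁ C₂, fun z u hz hu => ?_⟩
  rcases le_total ‖z‖ δ with h | h
  · exact (h₁ z u hz hu h).trans (le_max_left _ _)
  · exact (h₂ z u hz hu (by rwa [norm_zero, zero_add])).trans (le_max_right _ _)

end Stability

end QVE

/-! ### The theorem -/

open QVE
theorem mainTheorem5 {X : Type*} [MeasurableSpace X] (μ : Measure X) [IsProbabilityMeasure μ]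
    (S : BB X →L[ℂ] BB X) (k : X → X → ℝ) (a : BB X) (ha : IsRealValued a)
    (hA1 : IsSymmetricPositive μ S) (hA2 : IsSmoothingWithKernel μ S k)
    (hOut : NoOutliers μ k a)
    (hCases : (a = 0 ∧ IsBlockFullyIndecomposable μ k) ∨
      (IsUniformlyPrimitive μ S ∧ HasStrongDiagonal μ S)) :
    (∃! m : ℍ → BB X, IsSolution S a m) ∧
      (∀ m : ℍ → BB X, IsSolution S a m → nnorm Set.univ m < ∞) ∧
      (a = 0 ∧ IsBlockFullyIndecomposable μ k → IsUniformlyPrimitive μ S) := by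
  refine ⟨existsUnique_isSolution hA2 ha, fun m hm => ?_, ?_⟩
  · obtain ⟨C, hC⟩ : ∃ C : ℝ, ∀ (z : ℂ) (u : BB X), 0 < z.im → IsSolutionAt S a z u → ‖u‖ ≤ C := by
      rcases hCases with ⟨rfl, hB⟩ | ⟨hA3, hd⟩
      · obtain ⟨K, T, B, hB⟩ := hB.exists_isBlockBound
        exact hB.exists_bound hA2 hA1 hOut
      · exact exists_bound_of_hasStrongDiagonal hA2 hA1 ha hOut hA3 hd
    refine lt_of_le_of_lt ?_ (ENNReal.ofReal_lt_top (r := C))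
    exact iSup₂_le fun z _ => ENNReal.ofReal_le_ofReal (hC z (m z) z.im_pos (hm z))
  · rintro ⟨-, hB⟩
    obtain ⟨K, T, B, hB⟩ := hB.exists_isBlockBound
    exact hB.isUniformlyPrimitive hA2 hA1
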